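/- (Approximation of Wiener Measure.) Let $n\in\mathbb{N}$, $t>0$, $x\in\mathbb{R}^n$, and let $C([0,t],\mathbb{R}^n)$ carry the topology of uniform convergence and its Borel $\sigma$-algebra. Let $K_s(y,z)=(2\pi s)^{-n/2}\exp\bigl(-|y-z|^2/(2s)\bigr)$ be the heat kernel of $\mathbb{R}^n$. The Wiener measure $\mathbb{W}_x$ is the Borel probability measure on $C([0,t],\mathbb{R}^n)$ such that for every partition $\tau=\{0=\tau_0<\tau_1<\dots<\tau_N=t\}$, with $\Delta_j\tau=\tau_j-\tau_{j-1}$, and every bounded continuous $F:(\mathbb{R}^n)^N\to\mathbb{R}$, $$\int F(\gamma(\tau_1),\dots,\gamma(\tau_N))\,\mathrm{d}\mathbb{W}_x(\gamma)=\int_{(\mathbb{R}^n)^N}F(x_1,\dots,x_N)\prod_{j=1}^N K_{\Delta_j\tau}(x_j,x_{j-1})\,\mathrm{d}x_1\cdots\mathrm{d}x_N,\qquad x_0:=x.$$ For a partition $\tau$ as above let $H_{x;\tau}$ be the affine space of all $\gamma\in C([0,t],\mathbb{R}^n)$ with $\gamma(0)=x$ such that $\gamma|_{[\tau_{j-1},\tau_j]}$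 is a straight line (parametrized affinely) for each $j=1,\dots,N$. Its tangent space consists of the continuous vector fields $X:[0,t]\to\mathbb{R}^n$ that are affine on each $[\tau_{j-1},\tau_j]$ and satisfy $X(0)=0$. Let $\mathrm{d}^{H^1}\gamma$ be the Riemannian volume measure on $H_{x;\tau}$ of the flat metric $(X,Y)_{H^1}=\int_0^t\langle X'(s),Y'(s)\rangle\,\mathrm{d}s$, let $S_0[\gamma]=\frac12\int_0^t|\gamma'(s)|^2\,\mathrm{d}s$, and let $$\mathbb{W}_{x,\tau}:=(j_{x,\tau})_*\Bigl[(2\pi)^{-nN/2}\exp(-S_0[\gamma])\,\mathrm{d}^{H^1}\gamma\Bigr],$$ where $j_{x,\tau}:H_{x;\tau}\to C([0,t],\mathbb{R}^n)$ is the inclusion. Then the Wiener measure $\mathbb{W}_x$ exists and is unique, and as the mesh $|\tau|=\max_j\Delta_j\tau$ tends to zero, the measures $\mathbb{W}_{x,\tau}$ converge to $\mathbb{W}_x$ in the weak-$*$ topology of finite Borel measures on $C([0,t],\mathbb{R}^n)$, i.e. $\int f\,\mathrm{d}\mathbb{W}_{x,\tau}\to\int f\,\mathrm{d}\mathbb{W}_x$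 for every bounded continuous $f:C([0,t],\mathbb{R}^n)\to\mathbb{R}$. -/

import Mathlib

open MeasureTheory Filter Topology

noncomputable section

namespace WienerApprox

/-- The path space `C([0, t], ℝⁿ)`, with the topology of uniform convergence. -/
abbrev PathSpace (n : ℕ) (t : ℝ) : Type :=
  C(Set.Icc (0 : ℝ) t, EuclideanSpace ℝ (Fin n))

/-- The path space carries its Borel σ-algebra. -/
instance instMeasurableSpacePathSpace (n : ℕ) (t : ℝ) : MeasurableSpace (PathSpace n t) :=
  borel _

instance instBorelSpacePathSpace (n : ℕ) (t : ℝ) : BorelSpace (PathSpace n t) := ⟨rfl⟩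

/-- A partition `0 = τ₀ < τ₁ < ⋯ < τ_N = t` of the interval `[0, t]`. -/
structure TimePartition (t : ℝ) where
  N : ℕ
  node : Fin (N + 1) → ℝ
  strictMono_node : StrictMono node
  node_zero : node 0 = 0
  node_last : node (Fin.last N) = t

namespace TimePartition

variable {t : ℝ}

theorem node_mem (τ : TimePartition t) (i : Fin (τ.N + 1)) : τ.node i ∈ Set.Icc (0 : ℝ) t := by
  constructor
  · rw [← τ.node_zero]; exact τ.strictMono_node.monotone (Fin.zero_le i)
  · exact (τ.strictMono_node.monotone (Fin.le_last i)).trans τ.node_last.le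

/-- The node `τ_i` as a point of `[0, t]`. -/
def pt (τ : TimePartition t) (i : Fin (τ.N + 1)) : Set.Icc (0 : ℝ) t := ⟨τ.node i, τ.node_mem i⟩

/-- The length of the `j`-th subinterval (the subintervals being numbered from `0` to `N - 1`). -/
def step (τ : TimePartition t) (j : Fin τ.N) : ℝ := τ.node j.succ - τ.node j.castSucc

theorem step_pos (τ : TimePartition t) (j : Fin τ.N) : 0 < τ.step j :=
  sub_pos.2 (τ.strictMono_node (Fin.castSucc_lt_succ))

/-- The mesh `|τ|`, the maximal length of a subinterval. -/
def mesh (τ : TimePartition t) : ℝ := ⨆ j : Fin τ.N, τ.step j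

/-- The filter "the mesh tends to zero" on the partitions of `[0, t]`. -/
def meshToZero (t : ℝ) : Filter (TimePartition t) := comap mesh (𝓝 0)

end TimePartition

variable {n : ℕ} {t : ℝ}

/-! ### Polygon paths -/

/-- `γ` is a straight line on each subinterval of `τ`. -/
def IsPolygonal (τ : TimePartition t) (γ : PathSpace n t) : Prop :=
  ∀ (j : Fin τ.N) (s : Set.Icc (0 : ℝ) t), τ.node j.castSucc ≤ s → (s : ℝ) ≤ τ.node j.succ →
    γ s = γ (τ.pt j.castSucc) +
      (((s : ℝ) - τ.node j.castSucc) / τ.step j) • (γ (τ.pt j.succ) - γ (τ.pt j.castSucc))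

/-- The space `H_{x;τ}(ℝⁿ)` of polygon paths starting at `x`. -/
def polygonPaths (x : EuclideanSpace ℝ (Fin n)) (τ : TimePartition t) : Set (PathSpace n t) :=
  {γ | γ (τ.pt 0) = x ∧ IsPolygonal τ γ}

/-- The piecewise linear vector fields with vanishing initial value, as a space of paths. -/
def tangentSubmodule (n : ℕ) (τ : TimePartition t) : Submodule ℝ (PathSpace n t) where
  carrier := {X | X (τ.pt 0) = 0 ∧ IsPolygonal τ X}
  zero_mem' := ⟨by simp, fun j s _ _ => by simp⟩
  add_mem' := by
    rintro X Y ⟨hX0, hX⟩ ⟨hY0, hY⟩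
    refine ⟨by simp [hX0, hY0], fun j s h1 h2 => ?_⟩
    simp only [ContinuousMap.add_apply]
    rw [hX j s h1 h2, hY j s h1 h2]
    module
  smul_mem' := by
    rintro c X ⟨hX0, hX⟩
    refine ⟨by simp [hX0], fun j s h1 h2 => ?_⟩
    simp only [ContinuousMap.smul_apply]
    rw [hX j s h1 h2]
    module

/-- The tangent space of `H_{x;τ}(ℝⁿ)`. It is the vector space `tangentSubmodule n τ`, but will be
normed by the `H¹` metric and not by the supremum norm. -/
def TangentSpace (n : ℕ) (τ : TimePartition t) : Type := tangentSubmodule n τ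

instance (τ : TimePartition t) : AddCommGroup (TangentSpace n τ) :=
  inferInstanceAs (AddCommGroup (tangentSubmodule n τ))

instance (τ : TimePartition t) : Module ℝ (TangentSpace n τ) :=
  inferInstanceAs (Module ℝ (tangentSubmodule n τ))

/-- The underlying path of a tangent vector. -/
def TangentSpace.toPath (τ : TimePartition t) : TangentSpace n τ →ₗ[ℝ] PathSpace n t :=
  (tangentSubmodule n τ).subtype

theorem TangentSpace.isPolygonal {τ : TimePartition t} (X : TangentSpace n τ) :
    IsPolygonal τ (X.toPath τ) := X.2.2

/-- The derivative `γ'(s)` of a path at an interior time `s ∈ (0, t)` (the path is continued by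
zero outside `[0, t]`, which does not matter for interior times). -/
def velocity (γ : PathSpace n t) (s : ℝ) : EuclideanSpace ℝ (Fin n) :=
  deriv (Function.extend Subtype.val γ 0) s

/-- The pairing `∫₀ᵗ ⟨X'(s), Y'(s)⟩ ds`. -/
def pairingH1 (X Y : PathSpace n t) : ℝ :=
  ∫ s in (0 : ℝ)..t, inner ℝ (velocity X s) (velocity Y s)

/-- The action `S₀[γ] = ½ ∫₀ᵗ |γ'(s)|² ds`. -/
def action (γ : PathSpace n t) : ℝ := 2⁻¹ * ∫ s in (0 : ℝ)..t, ‖velocity γ s‖ ^ 2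

theorem velocity_eq {τ : TimePartition t} {γ : PathSpace n t} (hγ : IsPolygonal τ γ)
    (j : Fin τ.N) {s : ℝ} (hs : s ∈ Set.Ioo (τ.node j.castSucc) (τ.node j.succ)) :
    velocity γ s = (τ.step j)⁻¹ • (γ (τ.pt j.succ) - γ (τ.pt j.castSucc)) := by
  refine HasDerivAt.deriv ?_
  have h1 : HasDerivAt (fun u : ℝ => γ (τ.pt j.castSucc) +
      ((u - τ.node j.castSucc) / τ.step j) • (γ (τ.pt j.succ) - γ (τ.pt j.castSucc)))
      ((τ.step j)⁻¹ • (γ (τ.pt j.succ) - γ (τ.pt j.castSucc))) s := by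
    have h2 : HasDerivAt (fun u : ℝ => (u - τ.node j.castSucc) / τ.step j) (τ.step j)⁻¹ s := by
      simpa using ((hasDerivAt_id s).sub_const (τ.node j.castSucc)).div_const (τ.step j)
    simpa using (h2.smul_const (γ (τ.pt j.succ) - γ (τ.pt j.castSucc))).const_add
      (γ (τ.pt j.castSucc))
  refine h1.congr_of_eventuallyEq ?_
  filter_upwards [isOpen_Ioo.mem_nhds hs] with u hu
  have hu' : u ∈ Set.Icc (0 : ℝ) t :=
    ⟨(τ.node_mem _).1.trans hu.1.le, hu.2.le.trans (τ.node_mem _).2⟩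
  rw [← hγ j ⟨u, hu'⟩ hu.1.le hu.2.le]
  exact Subtype.val_injective.extend_apply γ 0 ⟨u, hu'⟩

/-- The `H¹` pairing of polygon paths in terms of their increments. -/
theorem pairingH1_eq {τ : TimePartition t} {X Y : PathSpace n t} (hX : IsPolygonal τ X)
    (hY : IsPolygonal τ Y) :
    pairingH1 X Y = ∑ j : Fin τ.N, (τ.step j)⁻¹ *
      inner ℝ (X (τ.pt j.succ) - X (τ.pt j.castSucc)) (Y (τ.pt j.succ) - Y (τ.pt j.castSucc)) := by
  have key : ∀ j : Fin τ.N, Set.EqOn (fun _ : ℝ => (τ.step j)⁻¹ * ((τ.step j)⁻¹ *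
      inner ℝ (X (τ.pt j.succ) - X (τ.pt j.castSucc)) (Y (τ.pt j.succ) - Y (τ.pt j.castSucc))))
      (fun s => inner ℝ (velocity X s) (velocity Y s))
      (Set.Ioo (τ.node j.castSucc) (τ.node j.succ)) := by
    intro j s hs
    simp only [velocity_eq hX j hs, velocity_eq hY j hs, real_inner_smul_left,
      real_inner_smul_right]
  have hle : ∀ j : Fin τ.N, τ.node j.castSucc ≤ τ.node j.succ := fun j =>
    (τ.strictMono_node Fin.castSucc_lt_succ).le
  let a : ℕ → ℝ := fun k => if h : k < τ.N + 1 then τ.node ⟨k, h⟩ else 0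
  have ha1 : ∀ j : Fin τ.N, a j = τ.node j.castSucc := fun j => by
    have : (j : ℕ) < τ.N + 1 := by omega
    simp only [a, this, dif_pos]; rfl
  have ha2 : ∀ j : Fin τ.N, a (j + 1) = τ.node j.succ := fun j => by
    have : (j : ℕ) + 1 < τ.N + 1 := by omega
    simp only [a, this, dif_pos]; rfl
  have h0 : a 0 = 0 := by simpa [a] using τ.node_zero
  have hN : a τ.N = t := by
    simp only [a, Nat.lt_succ_self, dif_pos]; exact τ.node_last
  have hsum := intervalIntegral.sum_integral_adjacent_intervals (μ := volume) (a := a) (n := τ.N)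
    (f := fun s => inner ℝ (velocity X s) (velocity Y s)) (fun k hk => by
      have e1 := ha1 ⟨k, hk⟩
      have e2 := ha2 ⟨k, hk⟩
      simp only at e1 e2
      rw [e1, e2]
      refine (intervalIntegrable_iff_integrableOn_Ioo_of_le (hle _)).2 ?_
      exact IntegrableOn.congr_fun (integrableOn_const (by simp)) (key ⟨k, hk⟩)
        measurableSet_Ioo)
  rw [h0, hN] at hsum
  rw [pairingH1, ← hsum, ← Fin.sum_univ_eq_sum_range
    (fun k => ∫ s in a k..a (k + 1), inner ℝ (velocity X s) (velocity Y s)) τ.N]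
  refine Finset.sum_congr rfl fun j _ => ?_
  rw [ha1, ha2, ← intervalIntegral.integral_congr_Ioo_of_le (hle j) (key j),
    intervalIntegral.integral_const, smul_eq_mul]
  have := (τ.step_pos j).ne'
  change τ.step j * _ = _
  field_simp

theorem eq_zero_of_increments {τ : TimePartition t} {X : PathSpace n t} (hX0 : X (τ.pt 0) = 0)
    (hX : IsPolygonal τ X) (h : ∀ j : Fin τ.N, X (τ.pt j.succ) - X (τ.pt j.castSucc) = 0) :
    X = 0 := by
  have hpt : ∀ i, X (τ.pt i) = 0 := fun i => by
    induction i using Fin.induction with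
    | zero => exact hX0
    | succ j ih => rw [sub_eq_zero.1 (h j), ih]
  have hall : ∀ i, ∀ s : Set.Icc (0 : ℝ) t, (s : ℝ) ≤ τ.node i → X s = 0 := fun i => by
    induction i using Fin.induction with
    | zero =>
      intro s hs
      rw [τ.node_zero] at hs
      have : s = τ.pt 0 := Subtype.ext ((le_antisymm hs s.2.1).trans τ.node_zero.symm)
      rw [this, hX0]
    | succ j ih =>
      intro s hs
      rcases le_total (s : ℝ) (τ.node j.castSucc) with h1 | h1
      · exact ih s h1
      · rw [hX j s h1 hs, h j, hpt]; simp
  ext1 s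
  exact hall (Fin.last _) s (s.2.2.trans τ.node_last.ge)

theorem finiteDimensional_tangentSpace (τ : TimePartition t) :
    Module.Finite ℝ (TangentSpace n τ) := by
  let ev : TangentSpace n τ →ₗ[ℝ] (Fin (τ.N + 1) → EuclideanSpace ℝ (Fin n)) :=
    { toFun := fun X i => TangentSpace.toPath τ X (τ.pt i)
      map_add' := fun X Y => by ext1 i; simp
      map_smul' := fun c X => by ext1 i; simp }
  refine FiniteDimensional.of_injective ev ((injective_iff_map_eq_zero ev).2 fun X hX => ?_)
  have h0 : ∀ i, TangentSpace.toPath τ X (τ.pt i) = 0 := fun i => congrFun hX i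
  exact Subtype.ext (eq_zero_of_increments X.2.1 X.2.2 fun j =>
    (congrArg₂ _ (h0 j.succ) (h0 j.castSucc)).trans (sub_zero _))

/-- The `H¹` metric `(X, Y) = ∫₀ᵗ ⟨X'(s), Y'(s)⟩ ds` on the tangent space. -/
@[reducible]
def coreH1 (n : ℕ) (τ : TimePartition t) : InnerProductSpace.Core ℝ (TangentSpace n τ) where
  inner X Y := pairingH1 (X.toPath τ) (Y.toPath τ)
  conj_inner_symm X Y := by
    simp only [pairingH1, conj_trivial]
    exact intervalIntegral.integral_congr fun s _ => real_inner_comm _ _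
  re_inner_nonneg X := by
    simp only [RCLike.re_to_real]
    rw [pairingH1_eq X.isPolygonal X.isPolygonal]
    exact Finset.sum_nonneg fun j _ =>
      mul_nonneg (inv_nonneg.2 (τ.step_pos j).le) real_inner_self_nonneg
  add_left X Y Z := by
    rw [pairingH1_eq (X + Y).isPolygonal Z.isPolygonal, pairingH1_eq X.isPolygonal Z.isPolygonal, pairingH1_eq Y.isPolygonal Z.isPolygonal,
      ← Finset.sum_add_distrib]
    refine Finset.sum_congr rfl fun j _ => ?_
    rw [map_add, ContinuousMap.add_apply, ContinuousMap.add_apply, add_sub_add_comm,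
      inner_add_left, mul_add]
  smul_left X Y c := by
    rw [pairingH1_eq (c • X).isPolygonal Y.isPolygonal, pairingH1_eq X.isPolygonal Y.isPolygonal, Finset.mul_sum]
    refine Finset.sum_congr rfl fun j _ => ?_
    rw [map_smul, ContinuousMap.smul_apply, ContinuousMap.smul_apply, ← smul_sub,
      real_inner_smul_left, conj_trivial]
    ring
  definite X hX := by
    rw [pairingH1_eq X.isPolygonal X.isPolygonal, Finset.sum_eq_zero_iff_of_nonneg fun j _ =>
      mul_nonneg (inv_nonneg.2 (τ.step_pos j).le) real_inner_self_nonneg] at hX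
    refine Subtype.ext (eq_zero_of_increments X.2.1 X.2.2 fun j => ?_)
    have := hX j (Finset.mem_univ j)
    rw [mul_eq_zero, inner_self_eq_zero] at this
    exact this.resolve_left (inv_ne_zero (τ.step_pos j).ne')

instance (τ : TimePartition t) : NormedAddCommGroup (TangentSpace n τ) :=
  (coreH1 n τ).toNormedAddCommGroup

instance (τ : TimePartition t) : InnerProductSpace ℝ (TangentSpace n τ) :=
  InnerProductSpace.ofCore (coreH1 n τ).toCore

instance (τ : TimePartition t) : FiniteDimensional ℝ (TangentSpace n τ) :=
  finiteDimensional_tangentSpace τ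

instance (τ : TimePartition t) : MeasurableSpace (TangentSpace n τ) := borel _

instance (τ : TimePartition t) : BorelSpace (TangentSpace n τ) := ⟨rfl⟩

theorem inner_tangentSpace (τ : TimePartition t) (X Y : TangentSpace n τ) :
    inner ℝ X Y = pairingH1 (X.toPath τ) (Y.toPath τ) := rfl

/-- The parametrization `X ↦ x + X` of the affine space `H_{x;τ}(ℝⁿ)` by its tangent space. -/
def translate (x : EuclideanSpace ℝ (Fin n)) (τ : TimePartition t) (X : TangentSpace n τ) :
    polygonPaths x τ :=
  ⟨ContinuousMap.const _ x + X.toPath τ, by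
    have h0 : X.toPath τ (τ.pt 0) = 0 := X.2.1
    have hp : IsPolygonal τ (X.toPath τ) := X.isPolygonal
    refine ⟨by simp [h0], fun j s h1 h2 => ?_⟩
    simp only [ContinuousMap.add_apply, ContinuousMap.const_apply]
    rw [hp j s h1 h2]
    module⟩

theorem continuous_translate (x : EuclideanSpace ℝ (Fin n)) (τ : TimePartition t) :
    Continuous (translate x τ) :=
  Continuous.subtype_mk (continuous_const.add
    (TangentSpace.toPath τ).continuous_of_finiteDimensional) _

theorem bijective_translate (x : EuclideanSpace ℝ (Fin n)) (τ : TimePartition t) :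
    Function.Bijective (translate x τ) := by
  constructor
  · intro X Y h
    exact Subtype.ext (add_left_cancel (congrArg Subtype.val h))
  · rintro ⟨γ, h0, hγ⟩
    refine ⟨⟨γ - ContinuousMap.const _ x, by simp [h0], fun j s h1 h2 => ?_⟩, ?_⟩
    · simp only [ContinuousMap.sub_apply, ContinuousMap.const_apply]
      rw [hγ j s h1 h2]
      module
    · exact Subtype.ext (add_sub_cancel _ _)

/-- The Riemannian volume measure `d^{H¹}γ` of the flat metric `(·, ·)_{H¹}` on `H_{x;τ}(ℝⁿ)`:
the translate to `H_{x;τ}(ℝⁿ)` of the Lebesgue measure of the Euclidean space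
`(TangentSpace n τ, (·, ·)_{H¹})`, which gives volume one to orthonormal parallelepipeds. -/
def volumeH1 (x : EuclideanSpace ℝ (Fin n)) (τ : TimePartition t) : Measure (polygonPaths x τ) :=
  (volume : Measure (TangentSpace n τ)).map (translate x τ)

/-- The measure `(2π)^{-nN/2} exp(-S₀[γ]) d^{H¹}γ` on `H_{x;τ}(ℝⁿ)`. -/
def gaussianH1 (x : EuclideanSpace ℝ (Fin n)) (τ : TimePartition t) :
    Measure (polygonPaths x τ) :=
  (volumeH1 x τ).withDensity fun γ =>
    ENNReal.ofReal ((2 * Real.pi) ^ (-((n : ℝ) * (τ.N : ℝ)) / 2) * Real.exp (-action γ.1))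

theorem action_translate (x : EuclideanSpace ℝ (Fin n)) (τ : TimePartition t)
    (X : TangentSpace n τ) : action (translate x τ X).1 = 2⁻¹ * ‖X‖ ^ 2 := by
  have ht : (0 : ℝ) ≤ t := (τ.node_mem 0).1.trans (τ.node_mem 0).2
  rw [← real_inner_self_eq_norm_sq X, inner_tangentSpace, action, pairingH1]
  congr 1
  refine intervalIntegral.integral_congr_Ioo_of_le ht fun s hs => ?_
  simp only [real_inner_self_eq_norm_sq]
  congr 2
  have : Function.extend Subtype.val (translate x τ X).1 0 =ᶠ[𝓝 s]
      fun u => x + Function.extend Subtype.val (X.toPath τ) 0 u := by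
    filter_upwards [isOpen_Ioo.mem_nhds hs] with u hu
    have hu' : u ∈ Set.Icc (0 : ℝ) t := ⟨hu.1.le, hu.2.le⟩
    have e1 := Subtype.val_injective.extend_apply (⇑(translate x τ X).1) 0 ⟨u, hu'⟩
    have e2 := Subtype.val_injective.extend_apply (⇑(X.toPath τ)) 0 ⟨u, hu'⟩
    simp only at e1 e2
    rw [e1, e2]
    rfl
  rw [velocity, this.deriv_eq, deriv_const_add]
  rfl

instance isFiniteMeasure_gaussianH1 (x : EuclideanSpace ℝ (Fin n)) (τ : TimePartition t) :
    IsFiniteMeasure (gaussianH1 x τ) := by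
  refine isFiniteMeasure_withDensity (ne_of_lt ?_)
  refine (lintegral_map_le _ _).trans_lt ?_
  simp_rw [action_translate]
  have h := (GaussianFourier.integrable_cexp_neg_mul_sq_norm_add (V := TangentSpace n τ)
    (b := 2⁻¹) (by norm_num) 0 0).norm.const_mul ((2 * Real.pi) ^ (-((n : ℝ) * (τ.N : ℝ)) / 2))
  refine lt_of_eq_of_lt (lintegral_congr fun X => ?_) h.lintegral_lt_top
  congr 2
  rw [Complex.norm_exp]
  congr 1
  simp
  norm_cast

/-- The measure `𝕎_{x,τ}` on `C([0, t], ℝⁿ)`: the pushforward of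
`(2π)^{-nN/2} exp(-S₀[γ]) d^{H¹}γ` under the inclusion of `H_{x;τ}(ℝⁿ)`. -/
def polygonMeasure (x : EuclideanSpace ℝ (Fin n)) (τ : TimePartition t) :
    FiniteMeasure (PathSpace n t) :=
  ⟨(gaussianH1 x τ).map Subtype.val, inferInstance⟩

/-! ### Wiener measure -/

/-- The heat kernel `K_t(x, y) = (2πt)^{-n/2} exp(-|x - y|² / (2t))` of `ℝⁿ`. -/
def heatKernel (t : ℝ) (x y : EuclideanSpace ℝ (Fin n)) : ℝ :=
  (2 * Real.pi * t) ^ (-(n : ℝ) / 2) * Real.exp (-‖x - y‖ ^ 2 / (2 * t))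

/-- `W` is the Wiener measure `𝕎_x`: the integral of every bounded continuous cylinder function
`γ ↦ F(γ(τ₁), …, γ(τ_N))` is
`∫ F(x₁, …, x_N) ∏_j K_{Δ_j τ}(x_j, x_{j-1}) dx₁ ⋯ dx_N`, where `x₀ = x`. -/
def IsWienerMeasure (x : EuclideanSpace ℝ (Fin n)) (W : ProbabilityMeasure (PathSpace n t)) :
    Prop :=
  ∀ (τ : TimePartition t)
    (F : BoundedContinuousFunction (Fin τ.N → EuclideanSpace ℝ (Fin n)) ℝ),
    ∫ γ, F (fun j => γ (τ.pt j.succ)) ∂(W : Measure (PathSpace n t)) =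
      ∫ y : Fin τ.N → EuclideanSpace ℝ (Fin n),
        F y * ∏ j : Fin τ.N, heatKernel (τ.step j) (y j)
          ((Fin.cons x y : Fin (τ.N + 1) → EuclideanSpace ℝ (Fin n)) j.castSucc)

end WienerApprox

end

open WienerApprox

/-! The approximating measures are polygonal interpolations of a Brownian path. The increments of a
tangent vector, divided by the square roots of the step lengths, are orthonormal coordinates for the
`H¹` metric (`tangentEquiv`), and the action is half the squared norm up to translation by `x`.
Hence `𝕎_{x,τ}` is a standard Gaussian in these coordinates, that is, the law of the polygon through
a Gaussian random walk (`coe_polygonMeasure`). The product of heat kernels is the joint density of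
the same walk (`map_gaussianWalk`).

So for a Wiener measure `W`, the measure `𝕎_{x,τ}` is the image of `W` under interpolation of a path
at the nodes of `τ` (`coe_polygonMeasure_eq_map`). Each path is uniformly continuous, so its
interpolations converge to it uniformly as the mesh tends to zero, and dominated convergence gives
weak convergence. Since `𝕎_{x,τ}` does not involve `W`, uniqueness of limits gives uniqueness of the
Wiener measure.

For existence, an isonormal process on `L²(ℝ × Fin n)`, evaluated at the indicators of `(0, s] ×
{a}`, gives a process `B` with the right finite-dimensional laws. The fourth moment of an increment
over time `δ` is a constant times `δ²`, so at dyadic level `m` the `2^m` fourth moments add up to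
`O(2^{-m})`. The dyadic interpolations of `B` are therefore almost surely uniformly Cauchy
(`ae_exists_summable_bound`, `dist_polygon_uniform_le`), and their limit agrees almost surely with
`B` at each fixed time. -/

noncomputable section

namespace WienerApprox

open ProbabilityTheory

/-! ### Gaussian densities and Gaussian random walks -/

section

section GaussianDensity

variable {V : Type*} [NormedAddCommGroup V] [InnerProductSpace ℝ V]

/-- The density of the Gaussian measure on `V` with mean `x` and covariance `s • id`. -/
def gaussianDensity (s : ℝ) (x v : V) : ℝ :=
  (2 * Real.pi * s) ^ (-(Module.finrank ℝ V : ℝ) / 2) * Real.exp (-‖v - x‖ ^ 2 / (2 * s))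

theorem continuous_gaussianDensity (s : ℝ) (x : V) : Continuous (gaussianDensity s x) := by
  unfold gaussianDensity; fun_prop

theorem gaussianDensity_nonneg {s : ℝ} (hs : 0 < s) (x v : V) : 0 ≤ gaussianDensity s x v := by
  unfold gaussianDensity; positivity

/-- Centring at `x` brings density times character into the form `exp(-b|v|² + c⟨t, v⟩)`, with `b =
1/(2s)` and `c = i`, whose integral is known. -/
theorem gaussianDensity_add_mul_cexp (s : ℝ) (x t v : V) :
    (gaussianDensity s x (v + x) : ℂ) * Complex.exp (inner ℝ (v + x) t * Complex.I) =
      (((2 * Real.pi * s) ^ (-(Module.finrank ℝ V : ℝ) / 2) : ℝ) *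
        Complex.exp (inner ℝ x t * Complex.I)) *
        Complex.exp (-((2 * s : ℝ) : ℂ)⁻¹ * ‖v‖ ^ 2 + Complex.I * (inner ℝ t v : ℝ)) := by
  rw [gaussianDensity, add_sub_cancel_right, Complex.ofReal_mul, Complex.ofReal_exp,
    mul_assoc (Complex.ofReal _), mul_assoc (Complex.ofReal _), ← Complex.exp_add,
    ← Complex.exp_add, inner_add_left, real_inner_comm t v]
  congr 2
  push_cast
  field_simp
  ring

variable [FiniteDimensional ℝ V] [MeasurableSpace V] [BorelSpace V]

theorem integrable_gaussianDensity {s : ℝ} (hs : 0 < s) (x : V) :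
    Integrable (gaussianDensity s x) := by
  -- Frequency zero: the character is `1`, and only the density remains.
  have h := (GaussianFourier.integrable_cexp_neg_mul_sq_norm_add (V := V)
    (b := ((2 * s : ℝ) : ℂ)⁻¹) (by rw [← Complex.ofReal_inv, Complex.ofReal_re]; positivity)
    Complex.I 0).const_mul ((((2 * Real.pi * s) ^ (-(Module.finrank ℝ V : ℝ) / 2) : ℝ) : ℂ) *
        Complex.exp ((inner ℝ x (0 : V) : ℝ) * Complex.I))
  simp_rw [← gaussianDensity_add_mul_cexp] at h
  have h2 := (h.comp_sub_right x).norm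
  refine h2.congr (.of_forall fun v => ?_)
  simp [abs_of_nonneg (gaussianDensity_nonneg hs x v)]

theorem isFiniteMeasure_withDensity_gaussianDensity {s : ℝ} (hs : 0 < s) (x : V) :
    IsFiniteMeasure ((volume : Measure V).withDensity
      fun v => ENNReal.ofReal (gaussianDensity s x v)) :=
  isFiniteMeasure_withDensity_ofReal (integrable_gaussianDensity hs x).2

/-- Both measures are finite with characteristic function `exp(i⟨x, t⟩ - s|t|²/2)`. -/
theorem map_stdGaussian_eq_withDensity {s : ℝ} (hs : 0 < s) (x : V) :
    (stdGaussian V).map (fun z => x + √s • z) =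
      volume.withDensity fun v => ENNReal.ofReal (gaussianDensity s x v) := by
  have := isFiniteMeasure_withDensity_gaussianDensity hs x
  have : IsFiniteMeasure ((stdGaussian V).map (fun z => x + √s • z)) :=
    Measure.isFiniteMeasure_map _ _
  apply Measure.ext_of_charFun
  ext t
  have e1 : charFun ((stdGaussian V).map (fun z => x + √s • z)) t =
      Complex.exp (inner ℝ x t * Complex.I) * Complex.exp (-(s * ‖t‖ ^ 2) / 2) := by
    rw [charFun_apply, integral_map (by fun_prop) (by fun_prop)]
    have h := charFun_stdGaussian (E := V) (√s • t)
    simp only [charFun_apply, inner_smul_right, norm_smul, Complex.ofReal_mul, mul_pow,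
      Real.norm_eq_abs, abs_of_nonneg (Real.sqrt_nonneg s)] at h
    simp_rw [inner_add_left, real_inner_smul_left, Complex.ofReal_add, add_mul, Complex.exp_add,
      integral_const_mul, Complex.ofReal_mul, h]
    rw [← Complex.ofReal_pow √s, Real.sq_sqrt hs.le]
  rw [e1, charFun_apply, integral_withDensity_eq_integral_toReal_smul
    (continuous_gaussianDensity s x).measurable.ennreal_ofReal (by simp)]
  rw [← integral_add_right_eq_self _ x]
  simp_rw [ENNReal.toReal_ofReal (gaussianDensity_nonneg hs _ _), Complex.real_smul,
    gaussianDensity_add_mul_cexp]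
  rw [integral_const_mul, GaussianFourier.integral_cexp_neg_mul_sq_norm_add
    (by rw [← Complex.ofReal_inv, Complex.ofReal_re]; positivity)]
  have hb : (Real.pi / ((2 * s : ℝ) : ℂ)⁻¹) ^ ((Module.finrank ℝ V : ℂ) / 2) =
      (((2 * Real.pi * s) ^ ((Module.finrank ℝ V : ℝ) / 2) : ℝ) : ℂ) := by
    rw [Complex.ofReal_cpow (by positivity)]
    push_cast
    congr 1
    field_simp
  rw [hb]
  have hp : (2 * Real.pi * s) ^ (-(Module.finrank ℝ V : ℝ) / 2) *
      (2 * Real.pi * s) ^ ((Module.finrank ℝ V : ℝ) / 2) = 1 := by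
    rw [← Real.rpow_add (by positivity), neg_div, neg_add_cancel, Real.rpow_zero]
  have hs' : (s : ℂ) ≠ 0 := by exact_mod_cast hs.ne'
  have hexp : Complex.I ^ 2 * (‖t‖ : ℂ) ^ 2 / (4 * ((2 * s : ℝ) : ℂ)⁻¹) =
      -(s * ‖t‖ ^ 2) / 2 := by
    rw [Complex.I_sq]
    push_cast
    field_simp
    ring
  rw [hexp]
  have hp' : (((2 * Real.pi * s) ^ (-(Module.finrank ℝ V : ℝ) / 2) : ℝ) : ℂ) *
      (((2 * Real.pi * s) ^ ((Module.finrank ℝ V : ℝ) / 2) : ℝ) : ℂ) = 1 := by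
    rw [← Complex.ofReal_mul, hp, Complex.ofReal_one]
  rw [mul_mul_mul_comm, hp', one_mul]

theorem stdGaussian_eq_withDensity :
    stdGaussian V = volume.withDensity fun v => ENNReal.ofReal (gaussianDensity 1 0 v) := by
  rw [← map_stdGaussian_eq_withDensity one_pos]
  simp

end GaussianDensity

/-! ### Heat kernel products as densities of random walks -/

variable {n : ℕ}

theorem heatKernel_eq_gaussianDensity (s : ℝ) (x y : EuclideanSpace ℝ (Fin n)) :
    heatKernel s y x = gaussianDensity s x y := by
  simp [heatKernel, gaussianDensity]

/-- The partial sums `x + ∑_{i < j} √(Δ i) z i`. -/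
def gaussianWalk (x : EuclideanSpace ℝ (Fin n)) {N : ℕ} (Δ : Fin N → ℝ)
    (z : Fin N → EuclideanSpace ℝ (Fin n)) : Fin (N + 1) → EuclideanSpace ℝ (Fin n) :=
  fun j => x + Fin.partialSum (fun i => √(Δ i) • z i) j

@[simp]
theorem gaussianWalk_zero (x : EuclideanSpace ℝ (Fin n)) {N : ℕ} (Δ : Fin N → ℝ)
    (z : Fin N → EuclideanSpace ℝ (Fin n)) : gaussianWalk x Δ z 0 = x := by
  simp [gaussianWalk]

theorem gaussianWalk_succ (x : EuclideanSpace ℝ (Fin n)) {N : ℕ} (Δ : Fin N → ℝ)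
    (z : Fin N → EuclideanSpace ℝ (Fin n)) (j : Fin N) :
    gaussianWalk x Δ z j.succ = gaussianWalk x Δ z j.castSucc + √(Δ j) • z j := by
  simp [gaussianWalk, Fin.partialSum_succ, add_assoc]

/-- The Markov property: after its first step the walk starts afresh from the point reached. The
induction in `lintegral_gaussianWalk` rests on this. -/
theorem gaussianWalk_cons (x : EuclideanSpace ℝ (Fin n)) {N : ℕ} (Δ : Fin (N + 1) → ℝ)
    (z₀ : EuclideanSpace ℝ (Fin n)) (z : Fin N → EuclideanSpace ℝ (Fin n)) (j : Fin (N + 1)) :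
    gaussianWalk x Δ (Fin.cons z₀ z) j.succ =
      gaussianWalk (x + √(Δ 0) • z₀) (Fin.tail Δ) z j := by
  simp only [gaussianWalk, Fin.partialSum_succ', Fin.cons_zero, add_assoc]
  rfl

theorem continuous_gaussianWalk (x : EuclideanSpace ℝ (Fin n)) {N : ℕ} (Δ : Fin N → ℝ) :
    Continuous (gaussianWalk x Δ) := by
  refine continuous_pi fun j => ?_
  induction j using Fin.induction with
  | zero => simpa using continuous_const
  | succ j ih =>
    simp_rw [gaussianWalk_succ]
    fun_prop

theorem measurable_gaussianWalk_succ (x : EuclideanSpace ℝ (Fin n)) {N : ℕ} (Δ : Fin N → ℝ) :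
    Measurable fun (z : Fin N → EuclideanSpace ℝ (Fin n)) (j : Fin N) =>
      gaussianWalk x Δ z j.succ :=
  measurable_pi_lambda _ fun j =>
    ((continuous_apply j.succ).comp (continuous_gaussianWalk x Δ)).measurable

theorem lintegral_pi_succ {α : Type*} [MeasurableSpace α] (μ : Measure α) [SigmaFinite μ]
    {N : ℕ} {G : (Fin (N + 1) → α) → ENNReal} (hG : Measurable G) :
    ∫⁻ y, G y ∂Measure.pi (fun _ => μ) =
      ∫⁻ a, ∫⁻ b, G (Fin.cons a b) ∂Measure.pi (fun _ => μ) ∂μ := by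
  have h := (measurePreserving_piFinSuccAbove (fun _ : Fin (N + 1) => μ) 0).symm
  rw [← h.lintegral_comp hG, lintegral_prod _ (by exact (hG.comp h.measurable).aemeasurable)]
  simp only [MeasurableEquiv.piFinSuccAbove, Fin.insertNthEquiv_zero]
  rfl

theorem continuous_heatKernel (s : ℝ) : Continuous fun p : EuclideanSpace ℝ (Fin n) ×
    EuclideanSpace ℝ (Fin n) => heatKernel s p.1 p.2 := by
  unfold heatKernel; fun_prop

theorem heatKernel_nonneg {s : ℝ} (hs : 0 < s) (x y : EuclideanSpace ℝ (Fin n)) :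
    0 ≤ heatKernel s x y :=
  heatKernel_eq_gaussianDensity s y x ▸ gaussianDensity_nonneg hs y x

theorem continuous_cons {α : Type*} [TopologicalSpace α] {N : ℕ} :
    Continuous fun p : α × (Fin N → α) => (Fin.cons p.1 p.2 : Fin (N + 1) → α) :=
  Continuous.finCons (A := fun _ => α) continuous_fst continuous_snd

theorem continuous_heatKernel_cons (s : ℝ) {N : ℕ} (j : Fin N) :
    Continuous fun p : EuclideanSpace ℝ (Fin n) × (Fin N → EuclideanSpace ℝ (Fin n)) =>
      heatKernel s (p.2 j)
        ((Fin.cons p.1 p.2 : Fin (N + 1) → EuclideanSpace ℝ (Fin n)) j.castSucc) := by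
  exact (continuous_heatKernel s).comp₂ (by fun_prop)
    ((continuous_apply (A := fun _ => EuclideanSpace ℝ (Fin n)) j.castSucc).comp continuous_cons)

theorem measurable_prod_heatKernel {N : ℕ} (Δ : Fin N → ℝ) (x : EuclideanSpace ℝ (Fin n)) :
    Measurable fun y : Fin N → EuclideanSpace ℝ (Fin n) => ∏ j, heatKernel (Δ j) (y j)
        ((Fin.cons x y : Fin (N + 1) → EuclideanSpace ℝ (Fin n)) j.castSucc) :=
  Finset.measurable_prod _ fun j _ => ((continuous_heatKernel_cons (Δ j) j).comp
      (Continuous.prodMk_right x)).measurable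

/-- Induction on the number of steps, by Tonelli: the substitution `a ↦ x + √(Δ 0) a` turns the
first Gaussian variable into the first heat kernel factor, and the remaining walk is covered by the
induction hypothesis. Values in `ENNReal` avoid integrability conditions. -/
theorem lintegral_gaussianWalk {N : ℕ} (Δ : Fin N → ℝ) (hΔ : ∀ j, 0 < Δ j)
    (x : EuclideanSpace ℝ (Fin n)) {F : (Fin N → EuclideanSpace ℝ (Fin n)) → ENNReal}
    (hF : Measurable F) :
    ∫⁻ z, F (fun j => gaussianWalk x Δ z j.succ)
        ∂Measure.pi (fun _ => stdGaussian (EuclideanSpace ℝ (Fin n))) =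
      ∫⁻ y, (∏ j, ENNReal.ofReal (heatKernel (Δ j) (y j)
        ((Fin.cons x y : Fin (N + 1) → EuclideanSpace ℝ (Fin n)) j.castSucc))) * F y := by
  induction N generalizing x with
  | zero =>
    simp only [volume_pi, Finset.univ_eq_empty, Finset.prod_empty, one_mul,
      Measure.pi_of_empty _ (0 : Fin 0 → EuclideanSpace ℝ (Fin n)), lintegral_dirac]
    congr 1
    exact Subsingleton.elim _ _
  | succ N ih =>
    have hm : Measurable fun y : Fin (N + 1) → EuclideanSpace ℝ (Fin n) =>
        (∏ j, ENNReal.ofReal (heatKernel (Δ j) (y j)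
        ((Fin.cons x y : Fin (N + 1 + 1) → EuclideanSpace ℝ (Fin n)) j.castSucc))) * F y :=
      (Finset.measurable_prod _ fun j _ => ((continuous_heatKernel_cons (Δ j) j).comp
        (Continuous.prodMk_right x)).measurable.ennreal_ofReal).mul hF
    have hw : Measurable fun z : Fin (N + 1) → EuclideanSpace ℝ (Fin n) =>
        F fun j => gaussianWalk x Δ z j.succ :=
      hF.comp (measurable_gaussianWalk_succ x Δ)
    rw [lintegral_pi_succ _ hw, volume_pi, lintegral_pi_succ _ hm]
    have hcons : ∀ a : EuclideanSpace ℝ (Fin n), Measurable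
        fun b : Fin N → EuclideanSpace ℝ (Fin n) => F (Fin.cons a b) := fun a =>
      hF.comp (continuous_cons.comp (Continuous.prodMk_right a)).measurable
    -- The integral over the later positions, given that the first position is `a`.
    let G : EuclideanSpace ℝ (Fin n) → ENNReal := fun a =>
      ∫⁻ b : Fin N → EuclideanSpace ℝ (Fin n),
        (∏ j, ENNReal.ofReal (heatKernel (Δ j.succ) (b j)
        ((Fin.cons a b : Fin (N + 1) → EuclideanSpace ℝ (Fin n)) j.castSucc))) * F (Fin.cons a b)
    have hG : Measurable G := by
      refine Measurable.lintegral_prod_right' (f := fun p : EuclideanSpace ℝ (Fin n) ×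
        (Fin N → EuclideanSpace ℝ (Fin n)) => (∏ j, ENNReal.ofReal (heatKernel (Δ j.succ) (p.2 j)
        ((Fin.cons p.1 p.2 : Fin (N + 1) → EuclideanSpace ℝ (Fin n)) j.castSucc))) *
          F (Fin.cons p.1 p.2)) ?_
      exact (Finset.measurable_prod _ fun j _ =>
        (continuous_heatKernel_cons (Δ j.succ) j).measurable.ennreal_ofReal).mul
          (hF.comp continuous_cons.measurable)
    have hleft : ∀ a : EuclideanSpace ℝ (Fin n),
        ∫⁻ b, F (fun j => gaussianWalk x Δ (Fin.cons a b) j.succ)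
          ∂Measure.pi (fun _ => stdGaussian (EuclideanSpace ℝ (Fin n))) =
        G (x + √(Δ 0) • a) := fun a => by
      refine Eq.trans ?_ (ih (Fin.tail Δ) (fun j => hΔ j.succ) (x + √(Δ 0) • a)
        (hcons (x + √(Δ 0) • a)))
      refine lintegral_congr fun b => congrArg F (funext fun j => ?_)
      rw [gaussianWalk_cons]
      refine Fin.cases ?_ (fun i => ?_) j <;> simp
    simp_rw [hleft]
    rw [← lintegral_map (f := G) (g := fun a => x + √(Δ 0) • a) hG (by fun_prop),
      map_stdGaussian_eq_withDensity (hΔ 0), lintegral_withDensity_eq_lintegral_mul _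
        (continuous_gaussianDensity _ _).measurable.ennreal_ofReal hG]
    refine lintegral_congr fun a => ?_
    simp only [Pi.mul_apply, G]
    rw [← lintegral_const_mul' _ _ ENNReal.ofReal_ne_top]
    refine lintegral_congr fun b => ?_
    rw [Fin.prod_univ_succ, mul_assoc, ← heatKernel_eq_gaussianDensity]
    rfl

/-- The heat kernel product is the joint density of the positions of a Gaussian random walk. -/
theorem map_gaussianWalk {N : ℕ} (Δ : Fin N → ℝ) (hΔ : ∀ j, 0 < Δ j)
    (x : EuclideanSpace ℝ (Fin n)) :
    (Measure.pi fun _ => stdGaussian (EuclideanSpace ℝ (Fin n))).map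
        (fun z j => gaussianWalk x Δ z (Fin.succ j)) =
      volume.withDensity fun y => ENNReal.ofReal (∏ j, heatKernel (Δ j) (y j)
        ((Fin.cons x y : Fin (N + 1) → EuclideanSpace ℝ (Fin n)) j.castSucc)) := by
  have hw := measurable_gaussianWalk_succ x Δ
  refine Measure.ext_of_lintegral _ fun F hF => ?_
  rw [lintegral_map hF hw, lintegral_gaussianWalk Δ hΔ x hF,
    lintegral_withDensity_eq_lintegral_mul _ _ hF]
  · refine lintegral_congr fun y => ?_
    rw [Pi.mul_apply, ENNReal.ofReal_prod_of_nonneg fun j _ => heatKernel_nonneg (hΔ j) _ _]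
  · exact (measurable_prod_heatKernel Δ x).ennreal_ofReal

theorem integral_gaussianWalk {N : ℕ} (Δ : Fin N → ℝ) (hΔ : ∀ j, 0 < Δ j)
    (x : EuclideanSpace ℝ (Fin n)) (F : (Fin N → EuclideanSpace ℝ (Fin n)) → ℝ) :
    ∫ y, F y ∂((Measure.pi fun _ => stdGaussian (EuclideanSpace ℝ (Fin n))).map
        (fun z j => gaussianWalk x Δ z (Fin.succ j))) =
      ∫ y, F y * ∏ j, heatKernel (Δ j) (y j)
        ((Fin.cons x y : Fin (N + 1) → EuclideanSpace ℝ (Fin n)) j.castSucc) := by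
  rw [map_gaussianWalk Δ hΔ x, integral_withDensity_eq_integral_toReal_smul
    (measurable_prod_heatKernel Δ x).ennreal_ofReal (by simp)]
  refine integral_congr_ae (.of_forall fun y => ?_)
  simp only [smul_eq_mul]
  rw [ENNReal.toReal_ofReal (Finset.prod_nonneg fun j _ => heatKernel_nonneg (hΔ j) _ _), mul_comm]

/-- The law of the Gaussian random walk, including its initial value. -/
def walkLaw (x : EuclideanSpace ℝ (Fin n)) {N : ℕ} (Δ : Fin N → ℝ) :
    Measure (Fin (N + 1) → EuclideanSpace ℝ (Fin n)) :=
  (Measure.pi fun _ => stdGaussian (EuclideanSpace ℝ (Fin n))).map (gaussianWalk x Δ)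

end

/-! ### Polygon paths and the standard Gaussian of the `H¹` metric -/

section

variable {n : ℕ} {t : ℝ}

namespace TimePartition

variable (τ : TimePartition t)

/-- The piecewise linear function that is `0` up to `τ_j` and `1` from `τ_{j+1}` on. -/
def ramp (j : Fin τ.N) (s : ℝ) : ℝ := min 1 (max 0 ((s - τ.node j.castSucc) / τ.step j))

theorem continuous_ramp (j : Fin τ.N) : Continuous (τ.ramp j) := by
  unfold ramp; fun_prop

theorem ramp_of_le {j : Fin τ.N} {s : ℝ} (hs : s ≤ τ.node j.castSucc) : τ.ramp j s = 0 := by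
  have : (s - τ.node j.castSucc) / τ.step j ≤ 0 :=
    div_nonpos_of_nonpos_of_nonneg (sub_nonpos.2 hs) (τ.step_pos j).le
  rw [ramp, max_eq_left this, min_eq_right zero_le_one]

theorem ramp_of_ge {j : Fin τ.N} {s : ℝ} (hs : τ.node j.succ ≤ s) : τ.ramp j s = 1 := by
  have : 1 ≤ (s - τ.node j.castSucc) / τ.step j := by
    rw [one_le_div (τ.step_pos j), step]; linarith
  rw [ramp, max_eq_right (zero_le_one.trans this), min_eq_left this]

theorem ramp_of_mem {j : Fin τ.N} {s : ℝ} (h1 : τ.node j.castSucc ≤ s)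
    (h2 : s ≤ τ.node j.succ) : τ.ramp j s = (s - τ.node j.castSucc) / τ.step j := by
  have e1 : (s - τ.node j.castSucc) / τ.step j ≤ 1 := by
    rw [div_le_one (τ.step_pos j), step]; linarith
  have e2 : 0 ≤ (s - τ.node j.castSucc) / τ.step j :=
    div_nonneg (sub_nonneg.2 h1) (τ.step_pos j).le
  rw [ramp, max_eq_right e2, min_eq_right e1]

/-- The first alternative is indispensable only for `N = 0`, which forces `t = 0`. -/
theorem eq_pt_zero_or_exists_mem (s : Set.Icc (0 : ℝ) t) :
    s = τ.pt 0 ∨ ∃ k : Fin τ.N, τ.node k.castSucc ≤ s ∧ (s : ℝ) ≤ τ.node k.succ := by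
  have key : ∀ i, (s : ℝ) ≤ τ.node i →
      s = τ.pt 0 ∨ ∃ k : Fin τ.N, τ.node k.castSucc ≤ s ∧ (s : ℝ) ≤ τ.node k.succ := fun i => by
    induction i using Fin.induction with
    | zero =>
      intro hs
      rw [τ.node_zero] at hs
      exact Or.inl (Subtype.ext ((le_antisymm hs s.2.1).trans τ.node_zero.symm))
    | succ j ih =>
      intro hs
      rcases le_total (s : ℝ) (τ.node j.castSucc) with h1 | h1
      · exact ih h1
      · exact Or.inr ⟨j, h1, hs⟩
  exact key (Fin.last _) (s.2.2.trans τ.node_last.ge)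

theorem sum_increments_lt {M : Type*} [AddCommGroup M] {N : ℕ} (c : Fin (N + 1) → M)
    (k : Fin (N + 1)) :
    ∑ j : Fin N, (if j.castSucc < k then c j.succ - c j.castSucc else 0) = c k - c 0 := by
  induction k using Fin.induction with
  | zero => simp
  | succ i ih =>
    have h : ∀ j : Fin N, (if j.castSucc < i.succ then c j.succ - c j.castSucc else 0) =
        (if j.castSucc < i.castSucc then c j.succ - c j.castSucc else 0) +
          if j = i then c j.succ - c j.castSucc else 0 := fun j => by
      rcases lt_trichotomy j i with h | h | h
      · simp [h, h.ne, Fin.castSucc_lt_succ_iff, h.le]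
      · simp [h]
      · simp [h.not_gt, h.ne', Fin.castSucc_lt_succ_iff, h.not_ge]
    simp_rw [h, Finset.sum_add_distrib, ih]
    simp

/-- The polygon path through the points `c i` at the times `τ_i`. -/
def polygon (c : Fin (τ.N + 1) → EuclideanSpace ℝ (Fin n)) : PathSpace n t where
  toFun s := c 0 + ∑ j : Fin τ.N, τ.ramp j s • (c j.succ - c j.castSucc)
  continuous_toFun := continuous_const.add (continuous_finsetSum _ fun j _ =>
    ((τ.continuous_ramp j).comp continuous_subtype_val).smul continuous_const)

theorem polygon_apply (c : Fin (τ.N + 1) → EuclideanSpace ℝ (Fin n)) (s : Set.Icc (0 : ℝ) t) :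
    τ.polygon c s = c 0 + ∑ j : Fin τ.N, τ.ramp j s • (c j.succ - c j.castSucc) := rfl

/-- On the `k`-th subinterval the earlier ramps equal `1` and the later ones `0`, so the sum
telescopes up to `c k.castSucc` and leaves one linear term. -/
theorem polygon_apply_of_mem (c : Fin (τ.N + 1) → EuclideanSpace ℝ (Fin n))
    (k : Fin τ.N) (s : Set.Icc (0 : ℝ) t) (h1 : τ.node k.castSucc ≤ s)
    (h2 : (s : ℝ) ≤ τ.node k.succ) :
    τ.polygon c s = c k.castSucc +
      (((s : ℝ) - τ.node k.castSucc) / τ.step k) • (c k.succ - c k.castSucc) := by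
  have h : ∀ j : Fin τ.N, τ.ramp j s • (c j.succ - c j.castSucc) =
      (if j.castSucc < k.castSucc then c j.succ - c j.castSucc else 0) +
        if j = k then (((s : ℝ) - τ.node k.castSucc) / τ.step k) • (c j.succ - c j.castSucc)
          else 0 := fun j => by
    rcases lt_trichotomy j k with h | h | h
    · rw [τ.ramp_of_ge ((τ.strictMono_node.monotone (Fin.succ_le_castSucc_iff.2 h)).trans h1)]
      simp [h, h.ne]
    · subst h
      rw [τ.ramp_of_mem h1 h2]
      simp
    · rw [τ.ramp_of_le (h2.trans (τ.strictMono_node.monotone (Fin.succ_le_castSucc_iff.2 h)))]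
      simp [h.not_gt, h.ne']
  rw [polygon_apply]
  simp_rw [h, Finset.sum_add_distrib, sum_increments_lt]
  simp [← add_assoc]

@[simp]
theorem polygon_pt (c : Fin (τ.N + 1) → EuclideanSpace ℝ (Fin n)) (i : Fin (τ.N + 1)) :
    τ.polygon c (τ.pt i) = c i := by
  refine Fin.cases ?_ (fun k => ?_) i
  · rw [polygon_apply, Finset.sum_eq_zero, add_zero]
    intro j _
    rw [τ.ramp_of_le (s := τ.pt 0) (τ.strictMono_node.monotone (Fin.zero_le _)), zero_smul]
  · rw [polygon_apply_of_mem τ c k (τ.pt k.succ)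
      (τ.strictMono_node.monotone (Fin.castSucc_lt_succ).le) le_rfl]
    change _ + (τ.step k / τ.step k) • _ = _
    rw [div_self (τ.step_pos k).ne', one_smul, add_sub_cancel]

theorem isPolygonal_polygon (c : Fin (τ.N + 1) → EuclideanSpace ℝ (Fin n)) :
    IsPolygonal τ (τ.polygon c) := fun j s h1 h2 => by
  rw [polygon_apply_of_mem τ c j s h1 h2, polygon_pt, polygon_pt]

theorem polygon_eq_of_isPolygonal {γ : PathSpace n t} (hγ : IsPolygonal τ γ) :
    τ.polygon (fun i => γ (τ.pt i)) = γ := by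
  ext1 s
  rcases τ.eq_pt_zero_or_exists_mem s with rfl | ⟨k, h1, h2⟩
  · rw [polygon_pt]
  · rw [polygon_apply_of_mem τ _ k s h1 h2, hγ k s h1 h2]

theorem continuous_polygon :
    Continuous (τ.polygon : (Fin (τ.N + 1) → EuclideanSpace ℝ (Fin n)) → PathSpace n t) := by
  refine ContinuousMap.continuous_of_continuous_uncurry _ ?_
  refine Continuous.add (by fun_prop) (continuous_finsetSum _ fun j _ => ?_)
  exact ((τ.continuous_ramp j).comp (by fun_prop)).smul (by fun_prop)

/-- With `gaussianWalk_increment`, this makes the walk and its normalized increments mutually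
inverse for a fixed starting point. -/
theorem gaussianWalk_nodes (c : Fin (τ.N + 1) → EuclideanSpace ℝ (Fin n)) :
    gaussianWalk (c 0) τ.step (fun j => (√(τ.step j))⁻¹ • (c j.succ - c j.castSucc)) = c := by
  ext1 i
  induction i using Fin.induction with
  | zero => simp
  | succ j ih =>
    have := (Real.sqrt_pos.2 (τ.step_pos j)).ne'
    rw [gaussianWalk_succ, ih, smul_inv_smul₀ this, add_sub_cancel]

theorem gaussianWalk_increment (x : EuclideanSpace ℝ (Fin n))
    (z : Fin τ.N → EuclideanSpace ℝ (Fin n)) (j : Fin τ.N) :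
    (√(τ.step j))⁻¹ • (gaussianWalk x τ.step z j.succ - gaussianWalk x τ.step z j.castSucc) =
      z j := by
  have := (Real.sqrt_pos.2 (τ.step_pos j)).ne'
  rw [gaussianWalk_succ, add_sub_cancel_left, inv_smul_smul₀ this]

/-- The normalized increments of a tangent vector are orthonormal coordinates for the
`H¹` metric. -/
def tangentEquiv (n : ℕ) {t : ℝ} (τ : TimePartition t) :
    TangentSpace n τ ≃ₗᵢ[ℝ] PiLp 2 fun _ : Fin τ.N => EuclideanSpace ℝ (Fin n) where
  toFun X := WithLp.toLp 2 fun j =>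
    (√(τ.step j))⁻¹ • (X.toPath τ (τ.pt j.succ) - X.toPath τ (τ.pt j.castSucc))
  map_add' X Y := by
    ext1 j
    simp only [map_add, ContinuousMap.add_apply, PiLp.add_apply]
    module
  map_smul' c X := by
    ext1 j
    simp only [map_smul, ContinuousMap.smul_apply, PiLp.smul_apply, RingHom.id_apply]
    module
  invFun z := ⟨τ.polygon (gaussianWalk 0 τ.step z), by simp, τ.isPolygonal_polygon _⟩
  left_inv X := by
    refine Subtype.ext ?_
    have h0 : X.toPath τ (τ.pt 0) = 0 := X.2.1
    have := τ.gaussianWalk_nodes fun i => X.toPath τ (τ.pt i)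
    simp only [h0] at this
    simp only [this]
    exact τ.polygon_eq_of_isPolygonal X.isPolygonal
  right_inv z := by
    ext1 j
    change (√(τ.step j))⁻¹ • (τ.polygon (gaussianWalk 0 τ.step z) (τ.pt j.succ) -
      τ.polygon (gaussianWalk 0 τ.step z) (τ.pt j.castSucc)) = _
    rw [polygon_pt, polygon_pt, gaussianWalk_increment]
  -- The square of the normalizing factor is the weight `(τ.step j)⁻¹` in `pairingH1_eq`.
  norm_map' X := by
    rw [← sq_eq_sq₀ (norm_nonneg _) (norm_nonneg _), ← real_inner_self_eq_norm_sq X,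
      inner_tangentSpace, pairingH1_eq X.isPolygonal X.isPolygonal, PiLp.norm_sq_eq_of_L2]
    refine Finset.sum_congr rfl fun j _ => ?_
    change ‖(√(τ.step j))⁻¹ • (X.toPath τ (τ.pt j.succ) - X.toPath τ (τ.pt j.castSucc))‖ ^ 2 = _
    rw [norm_smul, mul_pow, real_inner_self_eq_norm_sq, norm_inv, inv_pow, Real.norm_eq_abs, sq_abs,
      Real.sq_sqrt (τ.step_pos j).le]

theorem tangentEquiv_apply (X : TangentSpace n τ) (j : Fin τ.N) :
    τ.tangentEquiv n X j =
      (√(τ.step j))⁻¹ • (X.toPath τ (τ.pt j.succ) - X.toPath τ (τ.pt j.castSucc)) := rfl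

/-- The ramp sum sees only the increments of the walk, and these do not depend on the starting
point. -/
theorem translate_tangentEquiv_symm (x : EuclideanSpace ℝ (Fin n))
    (z : Fin τ.N → EuclideanSpace ℝ (Fin n)) :
    (translate x τ ((τ.tangentEquiv n).symm (WithLp.toLp 2 z))).1 =
      τ.polygon (gaussianWalk x τ.step z) := by
  have h : (translate x τ ((τ.tangentEquiv n).symm (WithLp.toLp 2 z))).1 =
    ContinuousMap.const _ x + τ.polygon (gaussianWalk 0 τ.step z) := rfl
  rw [h]
  ext1 s
  simp only [ContinuousMap.add_apply, ContinuousMap.const_apply, polygon_apply, gaussianWalk_succ,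
    gaussianWalk_zero, add_sub_cancel_left, zero_add]

/-- This identifies `(2π)^{-nN/2}` as the Gaussian normalization on the tangent space. -/
theorem finrank_tangentSpace : Module.finrank ℝ (TangentSpace n τ) = n * τ.N := by
  rw [(τ.tangentEquiv n).toLinearEquiv.finrank_eq,
    (WithLp.linearEquiv 2 ℝ (Fin τ.N → EuclideanSpace ℝ (Fin n))).finrank_eq]
  simp [Module.finrank_pi_fintype, mul_comm]

end TimePartition

/-- Characteristic functions multiply over the coordinates, while squared norms add in the `ℓ²`
product. -/
theorem map_toLp_pi_stdGaussian {ι V : Type*} [Fintype ι] [NormedAddCommGroup V]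
    [InnerProductSpace ℝ V] [FiniteDimensional ℝ V] [MeasurableSpace V] [BorelSpace V] :
    (Measure.pi fun _ : ι => stdGaussian V).map (WithLp.toLp 2) =
      stdGaussian (PiLp 2 fun _ : ι => V) := by
  apply Measure.ext_of_charFun
  ext v
  simp_rw [charFun_pi, charFun_stdGaussian, ← Complex.exp_sum, ← Finset.sum_div,
    Finset.sum_neg_distrib]
  norm_cast
  rw [PiLp.norm_sq_eq_of_L2]

theorem stdGaussian_tangentSpace (τ : TimePartition t) :
    stdGaussian (TangentSpace n τ) =
      (Measure.pi fun _ : Fin τ.N => stdGaussian (EuclideanSpace ℝ (Fin n))).map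
        fun z => (τ.tangentEquiv n).symm (WithLp.toLp 2 z) := by
  rw [← stdGaussian_map (τ.tangentEquiv n).symm, ← map_toLp_pi_stdGaussian,
    Measure.map_map (by fun_prop) (by fun_prop)]
  rfl

/-- `𝕎_{x,τ}` is the law of the polygon path with independent Gaussian increments. -/
theorem coe_polygonMeasure (x : EuclideanSpace ℝ (Fin n)) (τ : TimePartition t) :
    (polygonMeasure x τ : Measure (PathSpace n t)) =
      (walkLaw x τ.step).map τ.polygon := by
  -- A measurable left inverse of `translate x τ`. Writing the density through it lets the density
  -- pass under the pushforward.
  let ψ : polygonPaths x τ → TangentSpace n τ := fun γ => (τ.tangentEquiv n).symm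
    (WithLp.toLp 2 fun j => (√(τ.step j))⁻¹ • (γ.1 (τ.pt j.succ) - γ.1 (τ.pt j.castSucc)))
  have hψ : ∀ X, ψ (translate x τ X) = X := fun X => by
    rw [LinearIsometryEquiv.symm_apply_eq]
    ext1 j
    rw [τ.tangentEquiv_apply]
    simp [translate]
  have hψm : Measurable ψ := by
    refine Continuous.measurable ((τ.tangentEquiv n).symm.continuous.comp
      ((PiLp.continuous_toLp 2 _).comp (continuous_pi fun j => ?_)))
    have h : ∀ i, Continuous fun γ : polygonPaths x τ => γ.1 (τ.pt i) := fun i =>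
      (continuous_eval_const (τ.pt i)).comp continuous_subtype_val
    have h1 := h j.succ
    have h2 := h j.castSucc
    fun_prop
  have hdens : (fun γ : polygonPaths x τ => ENNReal.ofReal
      ((2 * Real.pi) ^ (-((n : ℝ) * (τ.N : ℝ)) / 2) * Real.exp (-action γ.1))) =
      fun γ => ENNReal.ofReal (gaussianDensity 1 0 (ψ γ)) := by
    ext1 γ
    obtain ⟨X, rfl⟩ := (bijective_translate x τ).2 γ
    rw [hψ, action_translate, gaussianDensity, τ.finrank_tangentSpace, mul_one, mul_one, sub_zero,
      Nat.cast_mul]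
    congr 3
    ring
  have hdm : Measurable fun γ => ENNReal.ofReal (gaussianDensity 1 0 (ψ γ)) :=
    ((continuous_gaussianDensity 1 0).measurable.comp hψm).ennreal_ofReal
  have htr := (continuous_translate x τ).measurable
  have h1 : gaussianH1 x τ = (stdGaussian (TangentSpace n τ)).map (translate x τ) := by
    rw [gaussianH1, hdens, volumeH1]
    refine Measure.ext_of_lintegral _ fun F hF => ?_
    rw [lintegral_withDensity_eq_lintegral_mul _ hdm hF, lintegral_map (hdm.mul hF) htr,
      lintegral_map hF htr, stdGaussian_eq_withDensity, lintegral_withDensity_eq_lintegral_mul _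
        (continuous_gaussianDensity _ _).measurable.ennreal_ofReal
        (g := fun X => F (translate x τ X)) (hF.comp htr)]
    simp only [Pi.mul_apply, hψ]
  have hw := (continuous_gaussianWalk x τ.step).measurable
  have hp := (τ.continuous_polygon (n := n)).measurable
  have he : Measurable fun z : Fin τ.N → EuclideanSpace ℝ (Fin n) =>
    (τ.tangentEquiv n).symm (WithLp.toLp 2 z) := by fun_prop
  change (gaussianH1 x τ).map Subtype.val = _
  rw [h1, stdGaussian_tangentSpace, Measure.map_map htr he,
    Measure.map_map measurable_subtype_coe (htr.comp he), walkLaw, Measure.map_map hp hw]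
  congr 1
  ext1 z
  exact τ.translate_tangentEquiv_symm x z

end

/-! ### Interpolation along partitions of vanishing mesh -/

section

variable {n : ℕ} {t : ℝ}

theorem tendsto_const_div_add_one (a : ℝ) :
    Tendsto (fun N : ℕ => a / ((N : ℝ) + 1)) atTop (𝓝 0) :=
  tendsto_const_div_atTop_nhds_zero_nat a |>.comp (tendsto_add_atTop_nat 1) |>.congr (by simp)

namespace TimePartition

/-- The partition of `[0, t]` into `N` intervals of equal length. -/
def uniform (ht : 0 < t) (N : ℕ) [NeZero N] : TimePartition t where
  N := N
  node i := t * i / N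
  strictMono_node i j hij := by
    have : (i : ℝ) < j := by exact_mod_cast hij
    have : (0 : ℝ) < N := by exact_mod_cast NeZero.pos N
    simp only
    gcongr
  node_zero := by simp
  node_last := by simp

theorem uniform_step (ht : 0 < t) (N : ℕ) [NeZero N] (j : Fin N) :
    (uniform ht N).step j = t / N := by
  change t * ((j.succ : Fin (N + 1)) : ℕ) / N - t * ((j.castSucc : Fin (N + 1)) : ℕ) / N = _
  simp only [Fin.val_succ, Fin.val_castSucc]
  push_cast
  ring

theorem uniform_mesh (ht : 0 < t) (N : ℕ) [NeZero N] : (uniform ht N).mesh = t / N :=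
  (iSup_congr (uniform_step ht N)).trans (ciSup_const (ι := Fin N))

theorem step_le_mesh (τ : TimePartition t) (j : Fin τ.N) : τ.step j ≤ τ.mesh :=
  le_ciSup (Set.finite_range _).bddAbove j

/-- Needed for limits along this filter to be unique; uniform partitions have arbitrarily small
mesh. -/
theorem neBot_meshToZero (ht : 0 < t) : (meshToZero t).NeBot := by
  refine comap_neBot fun s hs => ?_
  have h : Tendsto (fun N : ℕ => t / ((N : ℝ) + 1)) atTop (𝓝 0) :=
    tendsto_const_div_add_one t
  obtain ⟨N, hN⟩ := (h.eventually hs).exists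
  exact ⟨uniform ht (N + 1), by rwa [uniform_mesh, Nat.cast_add_one]⟩

/-- Dominated convergence along a filter requires this. -/
instance isCountablyGenerated_meshToZero : (meshToZero t).IsCountablyGenerated := by
  unfold meshToZero; infer_instance

/-- The values of a path at the nodes of a partition. -/
def nodeValues (τ : TimePartition t) (γ : PathSpace n t) :
    Fin (τ.N + 1) → EuclideanSpace ℝ (Fin n) := fun i => γ (τ.pt i)

theorem continuous_nodeValues (τ : TimePartition t) :
    Continuous (τ.nodeValues : PathSpace n t → _) :=
  continuous_pi fun i => continuous_eval_const (τ.pt i)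

/-- Closed balls are convex, and here the polygon lies on the segment between two vertices. -/
theorem dist_polygon_apply_le (τ : TimePartition t) (c : Fin (τ.N + 1) → EuclideanSpace ℝ (Fin n))
    (k : Fin τ.N) (s : Set.Icc (0 : ℝ) t) (h1 : τ.node k.castSucc ≤ s)
    (h2 : (s : ℝ) ≤ τ.node k.succ) (y : EuclideanSpace ℝ (Fin n)) {M : ℝ}
    (hl : dist (c k.castSucc) y ≤ M) (hr : dist (c k.succ) y ≤ M) :
    dist (τ.polygon c s) y ≤ M := by
  rw [polygon_apply_of_mem τ c k s h1 h2]
  refine (convex_closedBall y M).add_smul_sub_mem hl hr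
    ⟨div_nonneg (sub_nonneg.2 h1) (τ.step_pos k).le, ?_⟩
  rw [div_le_one (τ.step_pos k), step]
  linarith

theorem dist_polygon_nodeValues_le (τ : TimePartition t) (γ : PathSpace n t) {ε : ℝ} (hε : 0 ≤ ε)
    (h : ∀ (k : Fin τ.N) (s : Set.Icc (0 : ℝ) t), τ.node k.castSucc ≤ s →
      (s : ℝ) ≤ τ.node k.succ →
      dist (γ (τ.pt k.castSucc)) (γ s) ≤ ε ∧ dist (γ (τ.pt k.succ)) (γ s) ≤ ε) :
    dist (τ.polygon (τ.nodeValues γ)) γ ≤ ε := by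
  refine (ContinuousMap.dist_le hε).2 fun s => ?_
  rcases τ.eq_pt_zero_or_exists_mem s with rfl | ⟨k, h1, h2⟩
  · simpa [nodeValues] using hε
  · exact τ.dist_polygon_apply_le _ k s h1 h2 _ (h k s h1 h2).1 (h k s h1 h2).2

/-- Uniform continuity of `γ`: once the mesh is below `δ`, both ends of the subinterval containing
`s` are within `δ` of `s`. -/
theorem tendsto_polygon_nodeValues (γ : PathSpace n t) :
    Tendsto (fun τ : TimePartition t => τ.polygon (τ.nodeValues γ)) (meshToZero t) (𝓝 γ) := by
  rw [Metric.tendsto_nhds]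
  intro ε hε
  obtain ⟨δ, hδ, h⟩ := Metric.uniformContinuous_iff.1
    (CompactSpace.uniformContinuous_of_continuous γ.continuous) (ε / 2) (half_pos hε)
  have hmesh : ∀ᶠ τ : TimePartition t in meshToZero t, τ.mesh < δ :=
    tendsto_comap.eventually (gt_mem_nhds hδ)
  filter_upwards [hmesh] with τ hτ
  refine (τ.dist_polygon_nodeValues_le γ (half_pos hε).le fun k s h1 h2 => ?_).trans_lt
    (half_lt_self hε)
  have hk := (τ.step_le_mesh k).trans_lt hτ
  rw [step] at hk
  constructor
  · refine (h ?_).le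
    rw [Subtype.dist_eq, Real.dist_eq, abs_lt]
    change -δ < τ.node k.castSucc - s ∧ τ.node k.castSucc - s < δ
    constructor <;> linarith
  · refine (h ?_).le
    rw [Subtype.dist_eq, Real.dist_eq, abs_lt]
    change -δ < τ.node k.succ - s ∧ τ.node k.succ - s < δ
    constructor <;> linarith

end TimePartition

/-! ### Marginals of a Wiener measure, convergence and uniqueness -/

namespace IsWienerMeasure

variable {x : EuclideanSpace ℝ (Fin n)} {W : ProbabilityMeasure (PathSpace n t)}

/-- Bounded continuous functions determine a finite measure, and the heat kernel integral is an
integral against the walk's law. -/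
theorem map_nodes (hW : IsWienerMeasure x W) (τ : TimePartition t) :
    (W : Measure (PathSpace n t)).map (fun γ j => γ (τ.pt (Fin.succ j))) =
      (Measure.pi fun _ => stdGaussian (EuclideanSpace ℝ (Fin n))).map
        (fun z j => gaussianWalk x τ.step z (Fin.succ j)) := by
  have hm : Measurable fun (γ : PathSpace n t) (j : Fin τ.N) => γ (τ.pt j.succ) :=
    (continuous_pi fun j => continuous_eval_const (τ.pt (Fin.succ j))).measurable
  have := Measure.isProbabilityMeasure_map (μ := (W : Measure (PathSpace n t))) hm.aemeasurable
  have hw := measurable_gaussianWalk_succ x τ.step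
  have := Measure.isProbabilityMeasure_map
    (μ := Measure.pi fun _ : Fin τ.N => stdGaussian (EuclideanSpace ℝ (Fin n))) hw.aemeasurable
  refine ext_of_forall_integral_eq_of_IsFiniteMeasure fun F => ?_
  rw [integral_map hm.aemeasurable F.continuous.aestronglyMeasurable, hW τ F,
    integral_gaussianWalk _ τ.step_pos]

theorem map_eval_uniform (hW : IsWienerMeasure x W) (ht : 0 < t) (N : ℕ) :
    (W : Measure (PathSpace n t)).map
        (fun γ => γ ((TimePartition.uniform ht (N + 1)).pt (Fin.succ (0 : Fin (N + 1))))) =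
      (stdGaussian (EuclideanSpace ℝ (Fin n))).map fun z => x + √(t / (N + 1)) • z := by
  have h := congrArg (Measure.map fun y : Fin (N + 1) → EuclideanSpace ℝ (Fin n) => y 0)
    (hW.map_nodes (TimePartition.uniform ht (N + 1)))
  have hm : Measurable fun (γ : PathSpace n t) (j : Fin (N + 1)) =>
      γ ((TimePartition.uniform ht (N + 1)).pt (Fin.succ j)) :=
    (continuous_pi fun j => continuous_eval_const _).measurable
  have hw := measurable_gaussianWalk_succ x (TimePartition.uniform ht (N + 1)).step
  have h1 := Measure.map_map (μ := (W : Measure (PathSpace n t))) (measurable_pi_apply 0) hm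
  have h2 := Measure.map_map (μ := Measure.pi fun _ : Fin (N + 1) =>
    stdGaussian (EuclideanSpace ℝ (Fin n))) (measurable_pi_apply (0 : Fin (N + 1))) hw
  have h3 := (measurePreserving_eval
    (fun _ : Fin (N + 1) => stdGaussian (EuclideanSpace ℝ (Fin n))) 0).map_eq
  refine (h1.symm.trans h).trans (h2.trans ?_)
  refine Eq.trans ?_ ((Measure.map_map (μ := Measure.pi fun _ : Fin (N + 1) =>
    stdGaussian (EuclideanSpace ℝ (Fin n))) (g := fun z => x + √(t / (N + 1)) • z) (by fun_prop)
    (measurable_pi_apply 0)).symm.trans (congrArg _ h3))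
  refine congrArg (Measure.map · _) ?_
  ext1 z
  simp only [Function.comp]
  refine (gaussianWalk_succ x _ z 0).trans ?_
  rw [TimePartition.uniform_step]
  rw [Nat.cast_add_one]
  exact congrArg (· + _) (gaussianWalk_zero x _ z)

/-- The defining formula tests only positive times, so the initial value comes from continuity:
`γ(t/(N+1))` tends to `γ(0)`, while its law, Gaussian with mean `x` and covariance `t/(N+1)` times
the identity, concentrates at `x`. -/
theorem map_eval_zero (hW : IsWienerMeasure x W) (ht : 0 < t) :
    (W : Measure (PathSpace n t)).map (fun γ => γ ⟨0, le_rfl, ht.le⟩) = Measure.dirac x := by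
  have hm : ∀ s : Set.Icc (0 : ℝ) t, AEMeasurable (fun γ : PathSpace n t => γ s)
      (W : Measure (PathSpace n t)) := fun s => (continuous_eval_const s).measurable.aemeasurable
  have := Measure.isProbabilityMeasure_map (hm ⟨0, le_rfl, ht.le⟩)
  refine ext_of_forall_integral_eq_of_IsFiniteMeasure fun f => ?_
  rw [integral_map (hm _) f.continuous.aestronglyMeasurable, integral_dirac]
  have hN : Tendsto (fun N : ℕ => t / ((N : ℝ) + 1)) atTop (𝓝 0) :=
    tendsto_const_div_add_one t
  have hp : Tendsto (fun N : ℕ => (TimePartition.uniform ht (N + 1)).pt (Fin.succ (0 : Fin (N + 1))))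
      atTop (𝓝 ⟨0, le_rfl, ht.le⟩) := by
    rw [tendsto_subtype_rng]
    refine hN.congr fun N => ?_
    change _ = t * ((Fin.succ (0 : Fin (N + 1)) : Fin (N + 1 + 1)) : ℕ) / ((N + 1 : ℕ) : ℝ)
    simp
  have l1 : Tendsto (fun N : ℕ => ∫ γ, f (γ ((TimePartition.uniform ht (N + 1)).pt
      (Fin.succ (0 : Fin (N + 1))))) ∂(W : Measure (PathSpace n t))) atTop
      (𝓝 (∫ γ, f (γ ⟨0, le_rfl, ht.le⟩) ∂(W : Measure (PathSpace n t)))) := by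
    refine tendsto_integral_of_dominated_convergence (fun _ => ‖f‖) (fun N => ?_)
      (integrable_const _) (fun N => .of_forall fun γ => f.norm_coe_le_norm _)
      (.of_forall fun γ => (f.continuous.tendsto _).comp ((γ.continuous.tendsto _).comp hp))
    exact (f.continuous.comp (continuous_eval_const _)).aestronglyMeasurable
  have l2 : Tendsto (fun N : ℕ => ∫ z, f (x + √(t / (N + 1)) • z)
      ∂stdGaussian (EuclideanSpace ℝ (Fin n))) atTop
      (𝓝 (∫ _, f x ∂stdGaussian (EuclideanSpace ℝ (Fin n)))) := by
    refine tendsto_integral_of_dominated_convergence (fun _ => ‖f‖) (fun N => ?_)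
      (integrable_const _) (fun N => .of_forall fun γ => f.norm_coe_le_norm _)
      (.of_forall fun z => (f.continuous.tendsto x).comp ?_)
    · exact (f.continuous.comp (by fun_prop)).aestronglyMeasurable
    · have h0 := (Real.continuous_sqrt.tendsto 0).comp hN
      rw [Real.sqrt_zero] at h0
      simpa using (h0.smul_const z).const_add x
  rw [integral_const, probReal_univ, one_smul] at l2
  refine tendsto_nhds_unique l1 (l2.congr fun N => ?_)
  rw [← integral_map (φ := fun z => x + √(t / (N + 1)) • z) (by fun_prop)
    f.continuous.aestronglyMeasurable, ← hW.map_eval_uniform ht N,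
    integral_map (hm _) f.continuous.aestronglyMeasurable]

theorem map_nodeValues (hW : IsWienerMeasure x W) (ht : 0 < t) (τ : TimePartition t) :
    (W : Measure (PathSpace n t)).map τ.nodeValues = walkLaw x τ.step := by
  have h0 : ∀ᵐ γ ∂(W : Measure (PathSpace n t)), γ (τ.pt 0) = x := by
    have hpt : τ.pt 0 = ⟨0, le_rfl, ht.le⟩ := Subtype.ext τ.node_zero
    rw [hpt, ← ae_map_iff (p := fun y => y = x)
      (continuous_eval_const (⟨0, le_rfl, ht.le⟩ : Set.Icc (0 : ℝ) t)).measurable.aemeasurable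
      (measurableSet_singleton x), hW.map_eval_zero ht]
    exact (ae_dirac_iff (measurableSet_singleton x)).2 rfl
  have hc : Measurable fun y : Fin τ.N → EuclideanSpace ℝ (Fin n) =>
      (Fin.cons x y : Fin (τ.N + 1) → EuclideanSpace ℝ (Fin n)) :=
    (continuous_cons.comp (Continuous.prodMk_right x)).measurable
  have hm : Measurable fun (γ : PathSpace n t) (j : Fin τ.N) => γ (τ.pt j.succ) :=
    (continuous_pi fun j => continuous_eval_const (τ.pt (Fin.succ j))).measurable
  have hw := measurable_gaussianWalk_succ x τ.step
  have h1 : τ.nodeValues =ᵐ[(W : Measure (PathSpace n t))]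
      fun γ => (Fin.cons x fun j => γ (τ.pt j.succ) : Fin (τ.N + 1) → EuclideanSpace ℝ (Fin n)) := by
    filter_upwards [h0] with γ hγ
    ext1 i
    refine Fin.cases hγ (fun j => rfl) i
  rw [Measure.map_congr h1]
  refine (Measure.map_map hc hm).symm.trans ?_
  rw [hW.map_nodes τ, Measure.map_map hc hw, walkLaw]
  congr 1
  ext1 z
  ext1 i
  refine Fin.cases ?_ (fun j => rfl) i
  simp

/-- A coupling of all the polygon measures on one probability space, which reduces weak convergence
to convergence path by path. -/
theorem coe_polygonMeasure_eq_map (hW : IsWienerMeasure x W) (ht : 0 < t) (τ : TimePartition t) :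
    (polygonMeasure x τ : Measure (PathSpace n t)) =
      (W : Measure (PathSpace n t)).map fun γ => τ.polygon (τ.nodeValues γ) := by
  rw [coe_polygonMeasure, ← hW.map_nodeValues ht τ,
    Measure.map_map τ.continuous_polygon.measurable τ.continuous_nodeValues.measurable]
  rfl

/-- Convergence of the polygon measures to the Wiener measure: `𝕎_{x,τ}` is the law of the
polygonal interpolation of a Brownian path. -/
theorem tendsto_polygonMeasure (hW : IsWienerMeasure x W) (ht : 0 < t) :
    Tendsto (fun τ : TimePartition t => polygonMeasure x τ) (TimePartition.meshToZero t)
      (𝓝 W.toFiniteMeasure) := by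
  rw [FiniteMeasure.tendsto_iff_forall_integral_tendsto]
  intro f
  have hc : ∀ τ : TimePartition t, Continuous fun γ : PathSpace n t =>
    τ.polygon (τ.nodeValues γ) := fun τ => τ.continuous_polygon.comp τ.continuous_nodeValues
  have h : Tendsto (fun τ : TimePartition t => ∫ γ, f (τ.polygon (τ.nodeValues γ))
      ∂(W : Measure (PathSpace n t))) (TimePartition.meshToZero t)
      (𝓝 (∫ γ, f γ ∂(W : Measure (PathSpace n t)))) :=
    tendsto_integral_filter_of_dominated_convergence (fun _ => ‖f‖)
      (.of_forall fun τ => (f.continuous.comp (hc τ)).aestronglyMeasurable)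
      (.of_forall fun τ => .of_forall fun γ => f.norm_coe_le_norm _) (integrable_const _)
      (.of_forall fun γ =>
        (f.continuous.tendsto γ).comp (TimePartition.tendsto_polygon_nodeValues γ))
  refine h.congr fun τ => ?_
  rw [hW.coe_polygonMeasure_eq_map ht τ, integral_map (hc τ).measurable.aemeasurable
    f.continuous.aestronglyMeasurable]

/-- Both measures are limits of the same family, and weak limits of finite measures are unique. -/
theorem unique (ht : 0 < t) {W' : ProbabilityMeasure (PathSpace n t)} (hW : IsWienerMeasure x W)
    (hW' : IsWienerMeasure x W') : W = W' := by
  have := TimePartition.neBot_meshToZero ht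
  have h := tendsto_nhds_unique (hW.tendsto_polygonMeasure ht) (hW'.tendsto_polygonMeasure ht)
  have h' : (W.toFiniteMeasure : Measure (PathSpace n t)) = W'.toFiniteMeasure := by rw [h]
  exact Subtype.ext h'

end IsWienerMeasure

/-- A measure whose node values are Gaussian random walks is the Wiener measure. -/
theorem isWienerMeasure_of_map_nodeValues {x : EuclideanSpace ℝ (Fin n)}
    {W : ProbabilityMeasure (PathSpace n t)}
    (h : ∀ τ : TimePartition t,
      (W : Measure (PathSpace n t)).map τ.nodeValues = walkLaw x τ.step) :
    IsWienerMeasure x W := fun τ F => by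
  have hF : Continuous fun c : Fin (τ.N + 1) → EuclideanSpace ℝ (Fin n) => F fun j => c j.succ :=
    F.continuous.comp (by fun_prop)
  have hw := measurable_gaussianWalk_succ x τ.step
  rw [← integral_gaussianWalk _ τ.step_pos x F, integral_map hw.aemeasurable
    F.continuous.aestronglyMeasurable, ← integral_map (φ := gaussianWalk x τ.step)
      (f := fun c => F fun j => c j.succ) (continuous_gaussianWalk x τ.step).measurable.aemeasurable
      hF.aestronglyMeasurable]
  change _ = ∫ c, F (fun j => c j.succ) ∂walkLaw x τ.step
  rw [← h τ, integral_map τ.continuous_nodeValues.measurable.aemeasurable hF.aestronglyMeasurable]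
  rfl

end

section

/-! ### Isonormal Gaussian processes -/

section Isonormal

theorem norm_cexp_sub_cexp_le (x y : ℝ) :
    ‖Complex.exp (x * Complex.I) - Complex.exp (y * Complex.I)‖ ≤ ‖x - y‖ := by
  have h : Complex.exp (x * Complex.I) - Complex.exp (y * Complex.I) =
      Complex.exp (y * Complex.I) * (Complex.exp (Complex.I * ((x - y : ℝ) : ℂ)) - 1) := by
    rw [mul_sub, ← Complex.exp_add, mul_one]
    congr 2
    push_cast
    ring
  rw [h, norm_mul, Complex.norm_exp_ofReal_mul_I, one_mul]
  exact Real.norm_exp_I_mul_ofReal_sub_one_le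

theorem integrable_cexp_mul_I {Ω : Type*} [MeasurableSpace Ω] {P : Measure Ω}
    [IsFiniteMeasure P] {f : Ω → ℝ} (hf : AEStronglyMeasurable f P) :
    Integrable (fun ω => Complex.exp (f ω * Complex.I)) P := by
  refine Integrable.of_bound (C := 1) ?_ (.of_forall fun ω => ?_)
  · exact (by fun_prop : Continuous fun x : ℝ => Complex.exp (x * Complex.I)).comp_aestronglyMeasurable hf
  · rw [Complex.norm_exp_ofReal_mul_I]

/-- The map is 1-Lipschitz, because `u ↦ exp(iu)` is and the `L¹` norm is at most the `L²` norm
under a probability measure. It carries the Gaussian formula from a dense subspace to its closure.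
-/
theorem continuous_integral_cexp {Ω : Type*} [MeasurableSpace Ω] {P : Measure Ω}
    [IsProbabilityMeasure P] :
    Continuous fun f : Lp ℝ 2 P => ∫ ω, Complex.exp (f ω * Complex.I) ∂P := by
  refine LipschitzWith.continuous (K := 1) (LipschitzWith.of_dist_le_mul fun f g => ?_)
  rw [NNReal.coe_one, one_mul, dist_eq_norm, dist_eq_norm,
    ← integral_sub (integrable_cexp_mul_I (Lp.aestronglyMeasurable f))
      (integrable_cexp_mul_I (Lp.aestronglyMeasurable g))]
  have hint : Integrable (fun ω => f ω - g ω) P :=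
    ((Lp.memLp f).sub (Lp.memLp g)).integrable (by norm_num)
  have h1 : ∫ ω, ‖f ω - g ω‖ ∂P ≤ ‖f - g‖ := by
    rw [integral_norm_eq_lintegral_enorm hint.1, ← eLpNorm_one_eq_lintegral_enorm, Lp.norm_def]
    refine ENNReal.toReal_mono (Lp.eLpNorm_ne_top _) ?_
    rw [eLpNorm_congr_ae (Lp.coeFn_sub f g)]
    exact eLpNorm_le_eLpNorm_of_exponent_le (by norm_num) hint.1
  refine (norm_integral_le_integral_norm _).trans (le_trans ?_ h1)
  exact integral_mono_of_nonneg (.of_forall fun _ => norm_nonneg _) hint.norm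
    (.of_forall fun ω => norm_cexp_sub_cexp_le _ _)

variable (ι : Type*)

/-- The law of a family of independent standard normal random variables. -/
abbrev whiteNoise : Measure (ι → ℝ) := Measure.infinitePi fun _ => gaussianReal 0 1

variable {ι}

theorem memLp_eval_whiteNoise (i : ι) : MemLp (fun ω : ι → ℝ => ω i) 2 (whiteNoise ι) :=
  (IsGaussian.memLp_id (gaussianReal 0 1) 2 (by simp)).comp_measurePreserving
    (measurePreserving_eval_infinitePi (fun _ : ι => gaussianReal 0 1) i)

/-- The coordinates as elements of `L²`. -/
def whiteNoiseCoord (i : ι) : Lp ℝ 2 (whiteNoise ι) := (memLp_eval_whiteNoise i).toLp _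

theorem orthonormal_whiteNoiseCoord :
    Orthonormal ℝ (whiteNoiseCoord : ι → Lp ℝ 2 (whiteNoise ι)) := by
  classical
  have hmp := measurePreserving_eval_infinitePi (fun _ : ι => gaussianReal 0 1)
  rw [orthonormal_iff_ite]
  intro i j
  have h1 : inner ℝ (whiteNoiseCoord i) (whiteNoiseCoord j) =
      ∫ ω, ω i * ω j ∂whiteNoise ι := by
    rw [L2.inner_def]
    refine integral_congr_ae ?_
    filter_upwards [(memLp_eval_whiteNoise i).coeFn_toLp, (memLp_eval_whiteNoise j).coeFn_toLp]
      with ω h1 h2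
    rw [whiteNoiseCoord, whiteNoiseCoord, h1, h2]
    simp [mul_comm]
  rw [h1]
  split_ifs with hij
  · subst hij
    have h2 := (hmp i).hasLaw.integral_comp (f := fun x => x * x)
      (by fun_prop)
    have h3 := variance_eq_sub (μ := gaussianReal 0 1) IsGaussian.memLp_two_id
    rw [variance_id_gaussianReal] at h3
    simp only [Pi.pow_apply, id, integral_id_gaussianReal] at h3
    refine h2.trans ?_
    simpa [sq] using h3.symm
  · have hind : IndepFun (fun ω : ι → ℝ => ω i) (fun ω => ω j) (whiteNoise ι) :=
      (iIndepFun_infinitePi (P := fun _ : ι => gaussianReal 0 1) (X := fun _ => id)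
        fun _ => measurable_id).indepFun hij
    rw [hind.integral_fun_mul_eq_mul_integral
      (measurable_pi_apply i).aestronglyMeasurable (measurable_pi_apply j).aestronglyMeasurable]
    have h2 := (hmp i).hasLaw.integral_eq
    rw [integral_id_gaussianReal] at h2
    rw [show ∫ ω, ω i ∂whiteNoise ι = 0 from h2, zero_mul]

theorem integral_cexp_sum_whiteNoise (s : Finset ι) (c : ι → ℝ) :
    ∫ ω, Complex.exp ((∑ i ∈ s, c i * ω i : ℝ) * Complex.I) ∂whiteNoise ι =
      Complex.exp (-(∑ i ∈ s, c i ^ 2 : ℝ) / 2) := by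
  have h := integral_restrict_infinitePi (μ := fun _ : ι => gaussianReal 0 1) (s := s)
    (f := fun y => ∏ i : s, Complex.exp ((c i * y i : ℝ) * Complex.I))
    (Measurable.aestronglyMeasurable (by fun_prop))
  have h2 := integral_fintype_prod_eq_prod (ι := s) (𝕜 := ℂ) (E := fun _ => ℝ)
    (μ := fun _ => gaussianReal 0 1)
    (f := fun i x => Complex.exp ((c i * x : ℝ) * Complex.I))
  rw [h2] at h
  have h3 : ∀ i : s, ∫ x, Complex.exp ((c i * x : ℝ) * Complex.I) ∂gaussianReal 0 1 =
      Complex.exp (-(c i ^ 2 : ℝ) / 2) := fun i => by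
    have := charFun_gaussianReal (μ := 0) (v := 1) (c i)
    rw [charFun_apply_real] at this
    push_cast
    rw [this]
    simp [neg_div]
  simp_rw [h3, ← Complex.exp_sum] at h
  refine Eq.trans ?_ (h.trans ?_)
  · refine integral_congr_ae (.of_forall fun ω => ?_)
    simp only [Finset.restrict]
    rw [← Finset.sum_mul, Finset.sum_coe_sort s fun i => ((c i * ω i : ℝ) : ℂ),
      Complex.ofReal_sum]
  · rw [Finset.sum_coe_sort s fun i => -((c i ^ 2 : ℝ) : ℂ) / 2, ← Finset.sum_div,
      Finset.sum_neg_distrib, Complex.ofReal_sum]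

variable (H : Type*) [NormedAddCommGroup H] [InnerProductSpace ℝ H] [CompleteSpace H]

/-- Every real Hilbert space carries an isonormal Gaussian process. -/
theorem exists_isonormal : ∃ (w : Set H) (J : H →ₗᵢ[ℝ] Lp ℝ 2 (whiteNoise w)),
    ∀ h, ∫ ω, Complex.exp (J h ω * Complex.I) ∂whiteNoise w =
      Complex.exp (-(‖h‖ ^ 2 : ℝ) / 2) := by
  classical
  obtain ⟨w, b, -⟩ := exists_hilbertBasis ℝ H
  -- A Hilbert basis of `H` is sent to the independent standard normal coordinates.
  let J : H →ₗᵢ[ℝ] Lp ℝ 2 (whiteNoise w) :=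
    (orthonormal_whiteNoiseCoord (ι := w)).orthogonalFamily.linearIsometry.comp
      b.repr.toLinearIsometry
  have hJ : ∀ i, J (b i) = whiteNoiseCoord i := fun i => by
    change orthonormal_whiteNoiseCoord.orthogonalFamily.linearIsometry (b.repr (b i)) = _
    rw [b.repr_self i]
    refine (OrthogonalFamily.linearIsometry_apply_single _ _).trans ?_
    simp
  refine ⟨w, J, fun h => ?_⟩
  -- The formula defines a closed set and holds for finite combinations of basis vectors, which are
  -- dense.
  have hclosed : IsClosed {h : H | ∫ ω, Complex.exp (J h ω * Complex.I) ∂whiteNoise w =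
      Complex.exp (-(‖h‖ ^ 2 : ℝ) / 2)} :=
    isClosed_eq (continuous_integral_cexp.comp J.continuous) (by fun_prop)
  have hspan : (Submodule.span ℝ (Set.range b) : Set H) ⊆
      {h : H | ∫ ω, Complex.exp (J h ω * Complex.I) ∂whiteNoise w =
        Complex.exp (-(‖h‖ ^ 2 : ℝ) / 2)} := by
    intro h hh
    obtain ⟨c, rfl⟩ := (Finsupp.mem_span_range_iff_exists_finsupp).1 hh
    simp only [Set.mem_ofPred_eq, Finsupp.sum]
    have h1 : ‖∑ i ∈ c.support, c i • b i‖ ^ 2 = ∑ i ∈ c.support, c i ^ 2 := by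
      rw [← real_inner_self_eq_norm_sq, b.orthonormal.inner_sum]
      simp [sq]
    have h2 : J (∑ i ∈ c.support, c i • b i) =ᵐ[whiteNoise w]
        fun ω => ∑ i ∈ c.support, c i * ω i := by
      rw [map_sum]
      have h3 : ∀ᵐ ω ∂whiteNoise w, ∀ i ∈ c.support,
          (c i • whiteNoiseCoord i : Lp ℝ 2 (whiteNoise w)) ω = c i * ω i := by
        refine (Finset.eventually_all _).2 fun i _ => ?_
        filter_upwards [Lp.coeFn_smul (c i) (whiteNoiseCoord i),
          (memLp_eval_whiteNoise i).coeFn_toLp] with ω h1 h2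
        rw [h1, Pi.smul_apply, whiteNoiseCoord, h2, smul_eq_mul]
      filter_upwards [Lp.coeFn_finsetSum c.support fun i => J (c i • b i), h3] with ω h4 h5
      rw [h4, Finset.sum_apply]
      refine Finset.sum_congr rfl fun i hi => ?_
      rw [map_smul, hJ, h5 i hi]
    rw [h1, ← integral_cexp_sum_whiteNoise]
    refine integral_congr_ae ?_
    filter_upwards [h2] with ω hω
    rw [hω]
  have hdense : h ∈ closure (Submodule.span ℝ (Set.range b) : Set H) := by
    rw [← Submodule.topologicalClosure_coe, b.dense_span]
    trivial
  exact closure_minimal hspan hclosed hdense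

end Isonormal

end

section

/-! ### A process with the finite-dimensional distributions of Brownian motion -/

/-- Pairing the sum with `v` gives, almost surely, `J` of the single vector `∑ ⟨b i, v⟩ e i`, whose
norm is `‖v‖` by Parseval. -/
theorem map_sum_isonormal {H : Type*} [NormedAddCommGroup H] [InnerProductSpace ℝ H]
    {Ω : Type*} [MeasurableSpace Ω] {P : Measure Ω} [IsProbabilityMeasure P]
    {J : H →ₗᵢ[ℝ] Lp ℝ 2 P}
    (hJ : ∀ h, ∫ ω, Complex.exp (J h ω * Complex.I) ∂P = Complex.exp (-(‖h‖ ^ 2 : ℝ) / 2))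
    {V : Type*} [NormedAddCommGroup V] [InnerProductSpace ℝ V] [FiniteDimensional ℝ V]
    [MeasurableSpace V] [BorelSpace V] {ι : Type*} [Fintype ι] {e : ι → H}
    (he : Orthonormal ℝ e) (b : OrthonormalBasis ι ℝ V) :
    P.map (fun ω => ∑ i, J (e i) ω • b i) = stdGaussian V := by
  have hm : Measurable fun ω => ∑ i, J (e i) ω • b i :=
    Finset.measurable_sum _ fun i _ => (Lp.stronglyMeasurable _).measurable.smul_const _
  have := Measure.isProbabilityMeasure_map (μ := P) hm.aemeasurable
  apply Measure.ext_of_charFun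
  ext v
  have hnorm : ‖∑ i, (inner ℝ (b i) v) • e i‖ ^ 2 = ‖v‖ ^ 2 := by
    rw [← real_inner_self_eq_norm_sq, he.inner_sum, ← b.sum_sq_inner_right]
    simp [sq]
  have hae : J (∑ i, (inner ℝ (b i) v) • e i) =ᵐ[P]
      fun ω => inner ℝ (∑ i, J (e i) ω • b i) v := by
    rw [map_sum]
    have h3 : ∀ᵐ ω ∂P, ∀ i, (J (inner ℝ (b i) v • e i)) ω = inner ℝ (b i) v * J (e i) ω := by
      refine ae_all_iff.2 fun i => ?_
      rw [map_smul]
      filter_upwards [Lp.coeFn_smul (inner ℝ (b i) v) (J (e i))] with ω h1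
      rw [h1, Pi.smul_apply, smul_eq_mul]
    filter_upwards [Lp.coeFn_finsetSum Finset.univ fun i => J (inner ℝ (b i) v • e i), h3]
      with ω h4 h5
    rw [h4, Finset.sum_apply, sum_inner]
    refine Finset.sum_congr rfl fun i _ => ?_
    rw [h5, real_inner_smul_left, mul_comm]
  rw [charFun_apply, integral_map hm.aemeasurable (by fun_prop), charFun_stdGaussian]
  have h := hJ (∑ i, (inner ℝ (b i) v) • e i)
  rw [hnorm] at h
  push_cast at h
  rw [← h]
  refine integral_congr_ae ?_
  filter_upwards [hae] with ω hω
  rw [hω]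

theorem measure_Ioc_prod_singleton_ne_top {n : ℕ} (s : ℝ) (a : Fin n) :
    ((volume : Measure ℝ).prod (Measure.count : Measure (Fin n))) (Set.Ioc 0 s ×ˢ {a}) ≠ ⊤ := by
  simp [Measure.prod_prod]

/-- The indicator functions of `(0, s] × {a}` in `L²(ℝ × Fin n)`. -/
def stepVector {n : ℕ} (s : ℝ) (a : Fin n) :
    Lp ℝ 2 ((volume : Measure ℝ).prod (Measure.count : Measure (Fin n))) :=
  indicatorConstLp 2 (s := Set.Ioc 0 s ×ˢ {a}) (measurableSet_Ioc.prod (measurableSet_singleton a))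
    (measure_Ioc_prod_singleton_ne_top s a) (1 : ℝ)

/-- The measure of the intersection of the two sets, which is the covariance of Brownian motion. -/
theorem inner_stepVector {n : ℕ} {s u : ℝ} (hs : 0 ≤ s) (hu : 0 ≤ u) (a b : Fin n) :
    inner ℝ (stepVector s a) (stepVector u b) = if a = b then min s u else 0 := by
  rw [stepVector, stepVector, L2.inner_indicatorConstLp_indicatorConstLp _ _
    (measure_Ioc_prod_singleton_ne_top s a) (measure_Ioc_prod_singleton_ne_top u b),
    Set.prod_inter_prod, Set.Ioc_inter_Ioc, measureReal_def, Measure.prod_prod]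
  split_ifs with h
  · subst h
    simp [ENNReal.toReal_min, ENNReal.toReal_ofReal, hs, hu]
  · rw [Set.singleton_inter_eq_empty.2 (by simpa using h)]
    simp

theorem orthonormal_increment {n : ℕ} {s u : ℝ} (hs : 0 ≤ s) (hsu : s < u) :
    Orthonormal ℝ fun a : Fin n => (√(u - s))⁻¹ • (stepVector u a - stepVector s a) := by
  classical
  rw [orthonormal_iff_ite]
  intro a b
  have hu := hs.trans hsu.le
  simp only [real_inner_smul_left, real_inner_smul_right, inner_sub_left, inner_sub_right,
    inner_stepVector hs hs, inner_stepVector hs hu, inner_stepVector hu hs, inner_stepVector hu hu]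
  split_ifs
  · have h1 : √(u - s) * √(u - s) = u - s := Real.mul_self_sqrt (sub_pos.2 hsu).le
    have h2 := (Real.sqrt_pos.2 (sub_pos.2 hsu)).ne'
    rw [min_self, min_self, min_eq_left hsu.le, min_eq_right hsu.le]
    field_simp
    rw [sq, h1]
    ring
  · simp

theorem orthonormal_increments {n : ℕ} {t : ℝ} (τ : TimePartition t) :
    Orthonormal ℝ fun p : (_ : Fin τ.N) × Fin n => (√(τ.step p.1))⁻¹ •
      (stepVector (τ.node p.1.succ) p.2 - stepVector (τ.node p.1.castSucc) p.2) := by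
  classical
  rw [orthonormal_iff_ite]
  rintro ⟨j, a⟩ ⟨k, b⟩
  have h0 : ∀ i, 0 ≤ τ.node i := fun i => (τ.node_mem i).1
  simp only [real_inner_smul_left, real_inner_smul_right, inner_sub_left, inner_sub_right,
    inner_stepVector (h0 _) (h0 _), Sigma.mk.injEq, heq_eq_eq]
  by_cases hab : a = b
  swap
  · simp [hab]
  simp only [hab, if_true, and_true]
  have hj : τ.node j.castSucc ≤ τ.node j.succ := (τ.strictMono_node Fin.castSucc_lt_succ).le
  have hk : τ.node k.castSucc ≤ τ.node k.succ := (τ.strictMono_node Fin.castSucc_lt_succ).le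
  rcases lt_trichotomy j k with h | h | h
  -- For disjoint subintervals each minimum is the node of the earlier one, so the four terms
  -- cancel.
  · have hjk := τ.strictMono_node.monotone (Fin.succ_le_castSucc_iff.2 h)
    rw [min_eq_left (hjk.trans hk), min_eq_left hjk, min_eq_left ((hj.trans hjk).trans hk),
      min_eq_left (hj.trans hjk)]
    simp [h.ne]
  · subst h
    have hs := τ.step_pos j
    have h1 : √(τ.step j) * √(τ.step j) = τ.step j := Real.mul_self_sqrt hs.le
    have h2 := (Real.sqrt_pos.2 hs).ne'
    rw [min_self, min_self, min_eq_left hj, min_eq_right hj, if_pos rfl]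
    field_simp
    rw [sq, h1, TimePartition.step]
    ring
  · have hjk := τ.strictMono_node.monotone (Fin.succ_le_castSucc_iff.2 h)
    rw [min_eq_right (hjk.trans hj), min_eq_right hjk, min_eq_right ((hk.trans hjk).trans hj),
      min_eq_right (hk.trans hjk)]
    simp [h.ne']

variable {n : ℕ}

/-- There is a process, not necessarily continuous, with the finite-dimensional distributions
of Brownian motion. -/
theorem exists_brownian_process (x : EuclideanSpace ℝ (Fin n)) :
    ∃ (Ω : Type) (_ : MeasurableSpace Ω) (P : Measure Ω) (_ : IsProbabilityMeasure P)
      (B : ℝ → Ω → EuclideanSpace ℝ (Fin n)), (∀ s, Measurable (B s)) ∧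
      (∀ (t : ℝ) (τ : TimePartition t),
        P.map (fun ω i => B (τ.node i) ω) = walkLaw x τ.step) ∧
      ∀ s u : ℝ, 0 ≤ s → s < u →
        P.map (fun ω => (√(u - s))⁻¹ • (B u ω - B s ω)) =
          stdGaussian (EuclideanSpace ℝ (Fin n)) := by
  obtain ⟨w, J, hJ⟩ := exists_isonormal
    (Lp ℝ 2 ((volume : Measure ℝ).prod (Measure.count : Measure (Fin n))))
  let X : ℝ → (w → ℝ) → EuclideanSpace ℝ (Fin n) := fun s ω =>
    WithLp.toLp 2 fun a => J (stepVector s a) ω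
  have hX : ∀ s, Measurable (X s) := fun s => (WithLp.measurable_toLp 2 _).comp
    (measurable_pi_lambda _ fun a => (Lp.stronglyMeasurable _).measurable)
  -- Subtracting `X 0`, which vanishes only almost surely, makes `B 0 = x` hold for every `ω`.
  let B : ℝ → (w → ℝ) → EuclideanSpace ℝ (Fin n) := fun s ω => x + (X s ω - X 0 ω)
  have hB : ∀ s, Measurable (B s) := fun s => ((hX s).sub (hX 0)).const_add x
  have hBsub : ∀ s u ω, B u ω - B s ω = X u ω - X s ω := fun s u ω => by
    simp only [B]
    abel
  -- Elements of `L²` are linear in `J` only up to null sets, so this is stated for one combination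
  -- at a time and used for finitely many.
  have hincr : ∀ (c u s : ℝ) (a : Fin n), ∀ᵐ ω ∂whiteNoise w,
      J (c • (stepVector u a - stepVector s a)) ω = (c • (B u ω - B s ω)) a := fun c u s a => by
    rw [map_smul, map_sub]
    filter_upwards [Lp.coeFn_smul c (J (stepVector u a) - J (stepVector s a)),
      Lp.coeFn_sub (J (stepVector u a)) (J (stepVector s a))] with ω h1 h2
    rw [h1, Pi.smul_apply, h2, hBsub]
    rfl
  refine ⟨w → ℝ, inferInstance, whiteNoise w, inferInstance, B, hB, fun t τ => ?_,
    fun s u hs hu => ?_⟩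
  · let Z : (w → ℝ) → Fin τ.N → EuclideanSpace ℝ (Fin n) := fun ω j =>
      (√(τ.step j))⁻¹ • (B (τ.node j.succ) ω - B (τ.node j.castSucc) ω)
    have hZ : Measurable Z := by
      refine measurable_pi_lambda _ fun j => ?_
      change Measurable fun ω => (√(τ.step j))⁻¹ •
        (B (τ.node j.succ) ω - B (τ.node j.castSucc) ω)
      fun_prop
    have hlaw := map_sum_isonormal hJ (orthonormal_increments (n := n) τ)
      (Pi.orthonormalBasis fun _ : Fin τ.N => EuclideanSpace.basisFun (Fin n) ℝ)
    have hae : (fun ω => WithLp.toLp 2 (Z ω)) =ᵐ[whiteNoise w] fun ω =>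
        ∑ p : (_ : Fin τ.N) × Fin n, J ((√(τ.step p.1))⁻¹ • (stepVector (τ.node p.1.succ) p.2 -
          stepVector (τ.node p.1.castSucc) p.2)) ω •
            (Pi.orthonormalBasis fun _ : Fin τ.N => EuclideanSpace.basisFun (Fin n) ℝ) p := by
      have := ae_all_iff.2 fun p : (_ : Fin τ.N) × Fin n =>
        hincr (√(τ.step p.1))⁻¹ (τ.node p.1.succ) (τ.node p.1.castSucc) p.2
      filter_upwards [this] with ω hω
      simp_rw [hω]
      have h := (Pi.orthonormalBasis fun _ : Fin τ.N => EuclideanSpace.basisFun (Fin n) ℝ).sum_repr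
        (WithLp.toLp 2 (Z ω))
      refine h.symm.trans (Finset.sum_congr rfl fun p _ => ?_)
      rw [Pi.orthonormalBasis_repr]
      rfl
    rw [← Measure.map_congr hae, ← map_toLp_pi_stdGaussian,
      show (fun ω => WithLp.toLp 2 (Z ω)) = WithLp.toLp 2 ∘ Z from rfl,
      ← Measure.map_map (WithLp.measurable_toLp 2 _) hZ] at hlaw
    have hlaw' : (whiteNoise w).map Z =
        Measure.pi fun _ => stdGaussian (EuclideanSpace ℝ (Fin n)) :=
      (MeasurableEquiv.toLp 2 (Fin τ.N → EuclideanSpace ℝ (Fin n))).map_measurableEquiv_injective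
        hlaw
    rw [walkLaw, ← hlaw', Measure.map_map (continuous_gaussianWalk x τ.step).measurable hZ]
    congr 1
    ext1 ω
    have h0 : B (τ.node 0) ω = x := by simp [B, τ.node_zero]
    have := τ.gaussianWalk_nodes fun i => B (τ.node i) ω
    rw [h0] at this
    exact this.symm
  · rw [← map_sum_isonormal hJ (orthonormal_increment (n := n) hs hu)
      (EuclideanSpace.basisFun (Fin n) ℝ)]
    refine Measure.map_congr ?_
    filter_upwards [ae_all_iff.2 fun a => hincr (√(u - s))⁻¹ u s a] with ω hω
    simp_rw [hω]
    exact ((EuclideanSpace.basisFun (Fin n) ℝ).sum_repr _).symm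

end

section

/-! ### Existence of a continuous version -/

/-- Either `a ≤ q`, or `p * a ^ 3 ≥ p * q ^ 3 ≥ 1`. This bounds `a` by a summable term plus a
weighted fourth power. -/
theorem le_add_mul_pow_four {a q p : ℝ} (ha : 0 ≤ a) (hq : 0 < q) (hp : 1 ≤ p * q ^ 3) :
    a ≤ q + p * a ^ 4 := by
  have hp0 : 0 < p := by
    by_contra! h
    have := mul_nonpos_of_nonpos_of_nonneg h (pow_pos hq 3).le
    linarith
  rcases le_total a q with h | h
  · have : 0 ≤ p * a ^ 4 := by positivity
    linarith
  · have h3 : q ^ 3 ≤ a ^ 3 := by gcongr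
    have h4 : 1 ≤ p * a ^ 3 := hp.trans (by gcongr)
    have h5 : a * 1 ≤ a * (p * a ^ 3) := by gcongr
    linarith [show a * (p * a ^ 3) = p * a ^ 4 by ring]

/-- In place of Borel–Cantelli: the fourth powers weighted by `(3/2)^m` still have summable
expectation, so their sum is almost surely finite, and `le_add_mul_pow_four` returns to first
powers. -/
theorem ae_exists_summable_bound {Ω : Type*} [MeasurableSpace Ω] {P : Measure Ω}
    {κ : ℕ → Type*} [∀ m, Fintype (κ m)] {E : Type*} [NormedAddCommGroup E] [MeasurableSpace E]
    [BorelSpace E] {f : ∀ m, κ m → Ω → E} (hf : ∀ m k, Measurable (f m k)) {K : ENNReal}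
    (hK : K ≠ ⊤) (h : ∀ m, ∑ k, ∫⁻ ω, ‖f m k ω‖ₑ ^ 4 ∂P ≤ K * 2⁻¹ ^ m) :
    ∀ᵐ ω ∂P, ∃ b : ℕ → ℝ, Summable b ∧ ∀ m k, ‖f m k ω‖ ≤ b m := by
  -- The weight must satisfy `p / 2 < 1` for summability and `p * (9/10) ^ 3 ≥ 1` for the final
  -- estimate.
  let p : ENNReal := ENNReal.ofReal (3 / 2)
  let Z : ℕ → Ω → ENNReal := fun m ω => p ^ m * ∑ k, ‖f m k ω‖ₑ ^ 4
  have hfm : ∀ m k, Measurable fun ω => ‖f m k ω‖ₑ ^ 4 := fun m k => (hf m k).enorm.pow_const 4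
  have hsm : ∀ m, Measurable fun ω => ∑ k, ‖f m k ω‖ₑ ^ 4 := fun m =>
    Finset.measurable_fun_sum _ fun k _ => hfm m k
  have hZm : ∀ m, Measurable (Z m) := fun m => (hsm m).const_mul _
  have hp2 : p * 2⁻¹ = ENNReal.ofReal (3 / 4) := by
    rw [show (2⁻¹ : ENNReal) = ENNReal.ofReal 2⁻¹ by
      rw [ENNReal.ofReal_inv_of_pos two_pos, ENNReal.ofReal_ofNat], ← ENNReal.ofReal_mul (by norm_num)]
    norm_num
  have hZi : ∀ m, ∫⁻ ω, Z m ω ∂P ≤ K * ENNReal.ofReal (3 / 4) ^ m := fun m => by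
    rw [lintegral_const_mul _ (hsm m), lintegral_finsetSum _ fun k _ => hfm m k, ← hp2, mul_pow,
      mul_left_comm]
    gcongr
    exact h m
  have hsum : ∫⁻ ω, ∑' m, Z m ω ∂P ≠ ⊤ := by
    rw [lintegral_tsum fun m => (hZm m).aemeasurable]
    refine ne_top_of_le_ne_top ?_ (ENNReal.tsum_le_tsum hZi)
    rw [ENNReal.tsum_mul_left, ENNReal.tsum_geometric]
    refine ENNReal.mul_ne_top hK (ENNReal.inv_ne_top.2 ?_)
    rw [← ENNReal.ofReal_one, ← ENNReal.ofReal_sub _ (by norm_num)]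
    norm_num
  filter_upwards [ae_lt_top (Measurable.tsum hZm) hsum] with ω hω
  refine ⟨fun m => (9 / 10) ^ m + (Z m ω).toReal, Summable.add
    (summable_geometric_of_lt_one (by norm_num) (by norm_num)) (ENNReal.summable_toReal hω.ne),
    fun m k => ?_⟩
  have h1 : (3 / 2) ^ m * ‖f m k ω‖ ^ 4 ≤ (Z m ω).toReal := by
    rw [← ENNReal.ofReal_le_iff_le_toReal (ENNReal.ne_top_of_tsum_ne_top hω.ne m),
      ENNReal.ofReal_mul (by positivity), ENNReal.ofReal_pow (by norm_num),
      ENNReal.ofReal_pow (norm_nonneg _), ofReal_norm]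
    exact mul_le_mul_right (Finset.single_le_sum (f := fun k => ‖f m k ω‖ₑ ^ 4)
      (fun _ _ => zero_le) (Finset.mem_univ k)) _
  refine (le_add_mul_pow_four (norm_nonneg (f m k ω)) (q := (9 / 10) ^ m) (p := (3 / 2) ^ m)
    (by positivity) ?_).trans (add_le_add le_rfl h1)
  rw [← pow_mul, mul_comm m 3, pow_mul, ← mul_pow]
  exact one_le_pow₀ (by norm_num)

variable {n : ℕ} {t : ℝ}

theorem lintegral_enorm_pow_four_stdGaussian_ne_top :
    ∫⁻ z, ‖z‖ₑ ^ 4 ∂stdGaussian (EuclideanSpace ℝ (Fin n)) ≠ ⊤ := by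
  have h := lintegral_rpow_enorm_lt_top_of_eLpNorm_lt_top (p := 4) (by norm_num) (by norm_num)
    (IsGaussian.memLp_id (stdGaussian (EuclideanSpace ℝ (Fin n))) 4 (by norm_num)).2
  refine ne_of_lt (lt_of_eq_of_lt (lintegral_congr fun z => ?_) h)
  simp only [id, ENNReal.toReal_ofNat]
  exact_mod_cast (ENNReal.rpow_natCast _ 4).symm

/-- The exponent of `δ ^ 2` exceeds `1` and so beats the `2^m` increments of length `t / 2^m`;
second moments would leave a constant. -/
theorem lintegral_enorm_increment_pow_four {Ω : Type*} [MeasurableSpace Ω] {P : Measure Ω}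
    {X : Ω → EuclideanSpace ℝ (Fin n)} (hX : Measurable X) {δ : ℝ} (hδ : 0 < δ)
    (h : P.map (fun ω => (√δ)⁻¹ • X ω) = stdGaussian (EuclideanSpace ℝ (Fin n))) :
    ∫⁻ ω, ‖X ω‖ₑ ^ 4 ∂P =
      ENNReal.ofReal (δ ^ 2) * ∫⁻ z, ‖z‖ₑ ^ 4 ∂stdGaussian (EuclideanSpace ℝ (Fin n)) := by
  have hδ' := Real.sqrt_pos.2 hδ
  rw [← h, lintegral_map (by fun_prop) (by fun_prop), ← lintegral_const_mul _ (by fun_prop)]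
  refine lintegral_congr fun ω => ?_
  have h2 : ENNReal.ofReal (δ ^ 2) = ‖√δ‖ₑ ^ 4 := by
    rw [Real.enorm_of_nonneg hδ'.le, ← ENNReal.ofReal_pow hδ'.le]
    congr 1
    rw [show √δ ^ 4 = (√δ ^ 2) ^ 2 by ring, Real.sq_sqrt hδ.le]
  rw [h2, ← mul_pow, ← enorm_smul, smul_inv_smul₀ hδ'.ne']

namespace TimePartition

/-- Refining a uniform partition changes the interpolating polygon by at most twice the largest
increment. -/
theorem dist_polygon_uniform_le (ht : 0 < t) (N N' : ℕ) [NeZero N] [NeZero N'] (hN : N' = 2 * N)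
    (f : ℝ → EuclideanSpace ℝ (Fin n)) {M : ℝ} (hM : ∀ j : Fin N',
      ‖f ((uniform ht N').node (Fin.succ j)) - f ((uniform ht N').node (Fin.castSucc j))‖ ≤ M) :
    dist ((uniform ht N).polygon fun i => f ((uniform ht N).node i))
      ((uniform ht N').polygon fun i => f ((uniform ht N').node i)) ≤ 2 * M := by
  have hM0 : 0 ≤ M := (norm_nonneg _).trans (hM ⟨0, NeZero.pos N'⟩)
  have hN0 : (N : ℝ) ≠ 0 := NeZero.ne _
  have hN' : (N' : ℝ) = 2 * N := by rw [hN]; push_cast; rfl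
  let τ := uniform ht N
  let τ' := uniform ht N'
  -- The coarse node `i` is the fine node `2 * i`, so the coarse polygon interpolates the fine one.
  have hval : ∀ i : Fin (N + 1),
      τ'.polygon (fun i => f (τ'.node i)) (τ.pt i) = f (τ.node i) := fun i => by
    let i' : Fin (N' + 1) := ⟨2 * i, by omega⟩
    have hi : τ.node i = τ'.node i' := by
      change t * (i : ℕ) / N = t * ((2 * i : ℕ) : ℝ) / N'
      rw [hN']
      push_cast
      field_simp
    have hp : τ.pt i = τ'.pt i' := Subtype.ext hi
    rw [hp, hi]
    exact τ'.polygon_pt (fun i => f (τ'.node i)) i'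
  have hnode : (fun i => f (τ.node i)) = τ.nodeValues (τ'.polygon fun i => f (τ'.node i)) :=
    funext fun i => (hval i).symm
  change dist (τ.polygon fun i => f (τ.node i)) (τ'.polygon fun i => f (τ'.node i)) ≤ _
  rw [hnode]
  refine τ.dist_polygon_nodeValues_le _ (by positivity) fun (k : Fin N) s h1 h2 => ?_
  -- The two halves of the `k`-th coarse interval. Its end values are at most two fine increments
  -- apart, whence the bound `2 * M`.
  let j₀ : Fin N' := ⟨2 * k, by omega⟩
  let j₁ : Fin N' := ⟨2 * k + 1, by omega⟩
  have e0 : τ'.node (Fin.castSucc j₀) = τ.node (Fin.castSucc k) := by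
    change t * ((2 * k : ℕ) : ℝ) / N' = t * (k : ℕ) / N
    rw [hN']
    push_cast
    field_simp
  have e1 : τ'.node (Fin.castSucc j₁) = τ'.node (Fin.succ j₀) := rfl
  have e2 : τ'.node (Fin.succ j₁) = τ.node (Fin.succ k) := by
    change t * ((2 * k + 1 + 1 : ℕ) : ℝ) / N' = t * ((k + 1 : ℕ) : ℝ) / N
    rw [hN']
    push_cast
    field_simp
    ring
  have m0 := hM j₀
  have m1 := hM j₁
  change ‖f (τ'.node (Fin.succ j₀)) - f (τ'.node (Fin.castSucc j₀))‖ ≤ M at m0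
  change ‖f (τ'.node (Fin.succ j₁)) - f (τ'.node (Fin.castSucc j₁))‖ ≤ M at m1
  rw [← dist_eq_norm] at m0 m1
  rw [e0] at m0
  rw [e1, e2] at m1
  have m2 := (dist_triangle (f (τ.node (Fin.succ k))) (f (τ'.node (Fin.succ j₀)))
    (f (τ.node (Fin.castSucc k)))).trans (add_le_add m1 m0)
  rw [← two_mul] at m2
  have hM2 : M ≤ 2 * M := by linarith
  -- Over one coarse interval the fine polygon consists of two segments, so its distance to `y` is
  -- controlled at three vertices.
  have key : ∀ y : EuclideanSpace ℝ (Fin n), dist (f (τ.node (Fin.castSucc k))) y ≤ 2 * M →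
      dist (f (τ'.node (Fin.succ j₀))) y ≤ 2 * M → dist (f (τ.node (Fin.succ k))) y ≤ 2 * M →
      dist y (τ'.polygon (fun i => f (τ'.node i)) s) ≤ 2 * M := fun y y0 y1 y2 => by
    rw [dist_comm]
    rcases le_total (s : ℝ) (τ'.node (Fin.succ j₀)) with hs | hs
    · exact τ'.dist_polygon_apply_le _ j₀ s (e0.trans_le h1) hs y (by rwa [e0]) y1
    · exact τ'.dist_polygon_apply_le _ j₁ s hs (h2.trans_eq e2.symm) y y1 (by rwa [e2])
  constructor
  · refine (congrArg (dist · _) (hval _)).trans_le (key _ ?_ (m0.trans hM2) m2)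
    rw [dist_self]
    positivity
  · refine (congrArg (dist · _) (hval _)).trans_le (key _ ?_ ?_ ?_)
    · rwa [dist_comm]
    · rw [dist_comm]
      exact m1.trans hM2
    · rw [dist_self]
      positivity

end TimePartition

/-- The Wiener measure exists. -/
theorem exists_isWienerMeasure (ht : 0 < t) (x : EuclideanSpace ℝ (Fin n)) :
    ∃ W : ProbabilityMeasure (PathSpace n t), IsWienerMeasure x W := by
  obtain ⟨Ω, _, P, _, B, hB, hlaw, hincr⟩ := exists_brownian_process x
  let D : ℕ → TimePartition t := fun m => TimePartition.uniform ht (2 ^ m)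
  let Y : ℕ → Ω → PathSpace n t := fun m ω => (D m).polygon fun i => B ((D m).node i) ω
  have hY : ∀ m, Measurable (Y m) := fun m =>
    (D m).continuous_polygon.measurable.comp (measurable_pi_lambda _ fun i => hB _)
  let K : ENNReal := ∫⁻ z, ‖z‖ₑ ^ 4 ∂stdGaussian (EuclideanSpace ℝ (Fin n))
  have hK : K ≠ ⊤ := lintegral_enorm_pow_four_stdGaussian_ne_top
  have hmom : ∀ {s u δ : ℝ}, 0 ≤ s → s ≤ u → u - s ≤ δ →
      ∫⁻ ω, ‖B u ω - B s ω‖ₑ ^ 4 ∂P ≤ ENNReal.ofReal (δ ^ 2) * K := fun {s u δ} hs hsu hδ => by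
    rcases hsu.eq_or_lt with rfl | hsu
    · simp
    · refine (lintegral_enorm_increment_pow_four ((hB u).sub (hB s)) (sub_pos.2 hsu)
        (hincr s u hs hsu)).trans_le ?_
      gcongr
  -- The bound `(t / 2^m)²` per increment, summed over `2^m` increments, decays like `2^{-m}`.
  have hstep : ∀ m, ENNReal.ofReal ((t / 2 ^ m) ^ 2) * 2 ^ m = ENNReal.ofReal (t ^ 2) * 2⁻¹ ^ m :=
    fun m => by
      rw [show (2 : ENNReal) ^ m = ENNReal.ofReal (2 ^ m) by
          rw [ENNReal.ofReal_pow two_pos.le, ENNReal.ofReal_ofNat],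
        show (2⁻¹ : ENNReal) ^ m = ENNReal.ofReal (2⁻¹ ^ m) by
          rw [ENNReal.ofReal_pow (by norm_num), ENNReal.ofReal_inv_of_pos two_pos,
            ENNReal.ofReal_ofNat],
        ← ENNReal.ofReal_mul (by positivity), ← ENNReal.ofReal_mul (by positivity)]
      congr 1
      rw [inv_pow]
      field_simp
  have hDstep : ∀ m (j : Fin (D m).N), (D m).step j = t / 2 ^ m := fun m j => by
    refine (TimePartition.uniform_step ht (2 ^ m) j).trans ?_
    push_cast
    rfl
  have hcauchy : ∀ᵐ ω ∂P, ∃ γ, Tendsto (fun m => Y m ω) atTop (𝓝 γ) := by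
    have h := ae_exists_summable_bound (P := P) (κ := fun m => Fin (D m).N)
      (f := fun m j ω => B ((D m).node j.succ) ω - B ((D m).node j.castSucc) ω)
      (fun m j => (hB _).sub (hB _)) (K := ENNReal.ofReal (t ^ 2) * K)
      (ENNReal.mul_ne_top ENNReal.ofReal_ne_top hK) (fun m => by
        refine (Finset.sum_le_sum fun j _ => hmom ((D m).node_mem _).1
          ((D m).strictMono_node Fin.castSucc_lt_succ).le (hDstep m j).le).trans_eq ?_
        rw [Finset.sum_const, Finset.card_univ, Fintype.card_fin, nsmul_eq_mul,
          mul_right_comm _ K, ← hstep]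
        change ((2 ^ m : ℕ) : ENNReal) * _ = _
        push_cast
        ring)
    filter_upwards [h] with ω ⟨b, hb, hbd⟩
    refine cauchySeq_tendsto_of_complete (cauchySeq_of_dist_le_of_summable
      (fun m => 2 * b (m + 1)) (fun m => ?_) (((summable_nat_add_iff 1).2 hb).mul_left 2))
    exact TimePartition.dist_polygon_uniform_le ht (2 ^ m) (2 ^ (m + 1)) (by ring)
      (fun s => B s ω) fun j => hbd (m + 1) j
  obtain ⟨L, hL, hlim⟩ := measurable_limit_of_tendsto_metrizable_ae
    (fun m => (hY m).aemeasurable) hcauchy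
  -- The time `s` need not be dyadic, so `B s` is compared with `B` at the two level-`m` nodes
  -- enclosing `s`.
  have heval : ∀ s : Set.Icc (0 : ℝ) t, ∀ᵐ ω ∂P, L ω s = B s ω := fun s => by
    have hk : ∀ m, ∃ k : Fin (D m).N, (D m).node k.castSucc ≤ s ∧ (s : ℝ) ≤ (D m).node k.succ :=
      fun m => by
        rcases (D m).eq_pt_zero_or_exists_mem s with rfl | h
        · refine ⟨(⟨0, by positivity⟩ : Fin (2 ^ m)), le_rfl, ?_⟩
          exact (D m).strictMono_node.monotone (Fin.zero_le _)
        · exact h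
    choose k hk1 hk2 using hk
    have hks : ∀ m, (D m).node (k m).succ - (D m).node (k m).castSucc = t / 2 ^ m := fun m =>
      hDstep m (k m)
    -- `true` is the increment from `s` to the right node, `false` the one from the left node to
    -- `s`; the factor `2` in `K` counts them.
    have h := ae_exists_summable_bound (P := P) (κ := fun _ => Bool)
      (f := fun m c ω => cond c (B ((D m).node (k m).succ) ω - B s ω)
        (B s ω - B ((D m).node (k m).castSucc) ω))
      (fun m c => by cases c <;> exact (hB _).sub (hB _)) (K := 2 * (ENNReal.ofReal (t ^ 2) * K))
      (ENNReal.mul_ne_top (by norm_num) (ENNReal.mul_ne_top ENNReal.ofReal_ne_top hK))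
      (fun m => by
        rw [Fintype.sum_bool, mul_assoc, two_mul, mul_right_comm _ K, ← hstep]
        have hle : ENNReal.ofReal ((t / 2 ^ m) ^ 2) * K ≤
            ENNReal.ofReal ((t / 2 ^ m) ^ 2) * 2 ^ m * K := by
          gcongr
          exact le_mul_of_one_le_right zero_le (one_le_pow₀ one_le_two)
        have h1 := hk1 m
        have h2 := hk2 m
        have h3 := hks m
        exact add_le_add ((hmom s.2.1 h2 (by linarith)).trans hle)
          ((hmom ((D m).node_mem _).1 h1 (by linarith)).trans hle))
    filter_upwards [h, hlim] with ω ⟨b, hb, hbd⟩ hω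
    have h1 : Tendsto (fun m => Y m ω s) atTop (𝓝 (L ω s)) :=
      ((continuous_eval_const s).tendsto _).comp hω
    have h2 : Tendsto (fun m => Y m ω s) atTop (𝓝 (B s ω)) := by
      refine tendsto_iff_dist_tendsto_zero.2 (squeeze_zero (fun _ => dist_nonneg) (fun m => ?_)
        hb.tendsto_atTop_zero)
      refine (D m).dist_polygon_apply_le _ (k m) s (hk1 m) (hk2 m) _ ?_ ?_
      · rw [dist_comm, dist_eq_norm]
        exact hbd m false
      · rw [dist_eq_norm]
        exact hbd m true
    exact tendsto_nhds_unique h1 h2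
  -- Only finitely many nodes are involved, so almost sure agreement at each fixed time suffices.
  refine ⟨⟨P.map L, Measure.isProbabilityMeasure_map hL.aemeasurable⟩,
    isWienerMeasure_of_map_nodeValues fun τ => ?_⟩
  rw [← hlaw t τ]
  refine (Measure.map_map τ.continuous_nodeValues.measurable hL).trans (Measure.map_congr ?_)
  filter_upwards [ae_all_iff.2 fun i => heval (τ.pt i)] with ω hω
  exact funext hω

end

end WienerApprox

end

theorem mainTheorem8 (n : ℕ) (t : ℝ) (ht : 0 < t) (x : EuclideanSpace ℝ (Fin n)) :
    (∃! W : ProbabilityMeasure (PathSpace n t), IsWienerMeasure x W) ∧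
      ∀ W : ProbabilityMeasure (PathSpace n t), IsWienerMeasure x W →
        Tendsto (fun τ : TimePartition t => polygonMeasure x τ) (TimePartition.meshToZero t)
          (𝓝 W.toFiniteMeasure) := by
  refine ⟨?_, fun W hW => hW.tendsto_polygonMeasure ht⟩
  obtain ⟨W, hW⟩ := exists_isWienerMeasure ht x
  exact ⟨W, hW, fun W' hW' => hW'.unique ht hW⟩
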